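/- Let $p\in(0,1)$, let $d\in\mathbb N$, and let $\Gamma_1,\ldots,\Gamma_d$ be finite simple graphs, each with at least one edge. Write $v_{\Gamma}$, $e_{\Gamma}$ and $\mathrm{aut}(\Gamma)$ for the number of vertices, the number of edges and the automorphism group of a graph $\Gamma$. Let $\mathcal G(n,p)$ be the random graph on $n$ labelled vertices in which each of the $\binom n2$ possible edges is present independently with probability $p$, let $X_{\Gamma_i}$ be the number of (not necessarily induced) subgraphs of $\mathcal G(n,p)$ that are isomorphic to $\Gamma_i$, and put $$\mathbf X_{\mathbf\Gamma}=(\widetilde X_{\Gamma_1},\ldots,\widetilde X_{\Gamma_d}),\qquad \widetilde X_{\Gamma_i}:=n^{1-v_{\Gamma_i}}\bigl(X_{\Gamma_i}-\mathbb E[X_{\Gamma_i}]\bigr).$$ Let $\mathbf N_\Sigma$ be a centred Gaussian vector in $\mathbb R^d$ with covariance matrix $\Sigma=(\Sigma_{ij})_{i,j=1}^d$, where $$\Sigma_{ij}:=\sigma_i\sigma_j,\qquad \sigma_i:=\sqrt{2p(1-p)}\,\frac{e_{\Gamma_i}}{|\mathrm{aut}(\Gamma_i)|}\,p^{e_{\Gamma_i}-1}.$$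 For random vectors $\mathbf X,\mathbf Y$ in $\mathbb R^d$ let $d_4(\mathbf X,\mathbf Y):=\sup_g|\mathbb E[g(\mathbf X)]-\mathbb E[g(\mathbf Y)]|$, where the supremum runs over all functions $g:\mathbb R^d\to\mathbb R$ whose partial derivatives of orders $1,2,3,4$ all exist everywhere and are bounded in absolute value by $1$. Then there is a constant $c>0$, depending only on $\Gamma_1,\ldots,\Gamma_d$ and $p$, such that $$d_4(\mathbf X_{\mathbf\Gamma},\mathbf N_\Sigma)\le\frac cn$$ for all sufficiently large $n$. -/

import Mathlib

open MeasureTheory ProbabilityTheory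
open scoped ENNReal

noncomputable section

namespace SubgraphCLT

/-! ### The `d₄`-distance -/

/-- The partial derivative `∂g/∂xᵢ` of a function on `ℝᵈ`. -/
def partialDeriv {d : ℕ} (i : Fin d) (g : EuclideanSpace ℝ (Fin d) → ℝ) :
    EuclideanSpace ℝ (Fin d) → ℝ :=
  fun x => lineDeriv ℝ g x (EuclideanSpace.single i 1)

/-- The iterated partial derivative `∂ᵏg/∂x_{i₁}⋯∂x_{iₖ}` for the list `[i₁, …, iₖ]` (the
derivative in the last direction of the list is taken first). -/
def iterPartialDeriv {d : ℕ} :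
    List (Fin d) → (EuclideanSpace ℝ (Fin d) → ℝ) → EuclideanSpace ℝ (Fin d) → ℝ
  | [], g => g
  | i :: l, g => partialDeriv i (iterPartialDeriv l g)

/-- `g` is `n` times partially differentiable: all partial derivatives of orders `1, …, n` exist
at every point (no continuity is required). -/
def PartiallyDifferentiable {d : ℕ} (n : ℕ) (g : EuclideanSpace ℝ (Fin d) → ℝ) : Prop :=
  ∀ l : List (Fin d), l.length < n → ∀ (i : Fin d) (x : EuclideanSpace ℝ (Fin d)),
    LineDifferentiableAt ℝ (iterPartialDeriv l g) x (EuclideanSpace.single i 1)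

/-- `M_k(g)`: the largest supremum norm of a `k`-th order partial derivative of `g`
(`∞` if one of them is unbounded). -/
def M {d : ℕ} (k : ℕ) (g : EuclideanSpace ℝ (Fin d) → ℝ) : ℝ≥0∞ :=
  ⨆ (l : List (Fin d)) (_ : l.length = k) (x : EuclideanSpace ℝ (Fin d)),
    ‖iterPartialDeriv l g x‖ₑ

/-- The test functions of the `d₄`-distance: four times partially differentiable functions with
`M₁(g), M₂(g), M₃(g), M₄(g) ≤ 1`. -/
def testFunctions (d : ℕ) : Set (EuclideanSpace ℝ (Fin d) → ℝ) :=
  {g | PartiallyDifferentiable 4 g ∧ M 1 g ≤ 1 ∧ M 2 g ≤ 1 ∧ M 3 g ≤ 1 ∧ M 4 g ≤ 1}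

/-- The `d₄`-distance between two distributions on `ℝᵈ`, with values in `[0, ∞]`. Test functions
are Lipschitz, so the integrals exist as soon as the distributions have a finite first moment. -/
def d4 {d : ℕ} (μ ν : Measure (EuclideanSpace ℝ (Fin d))) : ℝ≥0∞ :=
  ⨆ g ∈ testFunctions d, ENNReal.ofReal |(∫ x, g x ∂μ) - ∫ x, g x ∂ν|

/-! ### Subgraph counts in the binomial random graph -/

/-- The normalized subgraph count `n^{1-v_Γ} (X_Γ - 𝔼 X_Γ)`, as a random variable on the
probability space of `G(n,p)`; here `X_Γ` is the number of subgraphs isomorphic to `Γ`. -/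
def normalizedCount {V : Type*} [Fintype V] (Γ : SimpleGraph V) (p : unitInterval) (n : ℕ)
    (G : SimpleGraph (Fin n)) : ℝ :=
  (n : ℝ) ^ (1 - (Fintype.card V : ℤ)) *
    ((G.copyCount Γ : ℝ) -
      ∫ H, (SimpleGraph.copyCount H Γ : ℝ) ∂(SimpleGraph.binomialRandom (Fin n) p))

/-- The random vector of the normalized subgraph counts of `Γ₁, …, Γ_d`. -/
def countVector {d : ℕ} {V : Fin d → Type*} [∀ i, Fintype (V i)] (Γ : ∀ i, SimpleGraph (V i))
    (p : unitInterval) (n : ℕ) (G : SimpleGraph (Fin n)) : EuclideanSpace ℝ (Fin d) :=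
  WithLp.toLp 2 fun i => normalizedCount (Γ i) p n G

/-- Every function on the finite probability space of `G(n,p)` is measurable, so the push-forward
that defines the law of the vector of counts is the genuine one. -/
theorem measurable_countVector {d : ℕ} {V : Fin d → Type*} [∀ i, Fintype (V i)]
    (Γ : ∀ i, SimpleGraph (V i)) (p : unitInterval) (n : ℕ) :
    Measurable (countVector Γ p n) := by
  have h : ∀ G : SimpleGraph (Fin n), MeasurableSet {G} := fun G => by
    have e := SimpleGraph.measurableEmbedding_edgeSet (V := Fin n)
    have h1 := e.measurable (measurableSet_singleton G.edgeSet)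
    have h2 : SimpleGraph.edgeSet ⁻¹' {G.edgeSet} = {G} := by
      ext H
      simp
    rwa [h2] at h1
  have : MeasurableSingletonClass (SimpleGraph (Fin n)) := ⟨h⟩
  exact measurable_of_countable _

/-- The law of the random vector of the normalized subgraph counts in `G(n,p)`. -/
def countLaw {d : ℕ} {V : Fin d → Type*} [∀ i, Fintype (V i)] (Γ : ∀ i, SimpleGraph (V i))
    (p : unitInterval) (n : ℕ) : Measure (EuclideanSpace ℝ (Fin d)) :=
  (SimpleGraph.binomialRandom (Fin n) p).map (countVector Γ p n)

/-- `σ_Γ = √(2p(1-p)) · e_Γ / |aut Γ| · p^{e_Γ - 1}`. -/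
def sigma {V : Type*} (Γ : SimpleGraph V) (p : unitInterval) : ℝ :=
  Real.sqrt (2 * (p : ℝ) * (1 - (p : ℝ))) *
    ((Γ.edgeSet.ncard : ℝ) / (Nat.card (Γ ≃g Γ) : ℝ)) * (p : ℝ) ^ (Γ.edgeSet.ncard - 1)

/-- The limiting covariance matrix `Σᵢⱼ = σᵢ σⱼ`. -/
def limitCov {d : ℕ} {V : Fin d → Type*} (Γ : ∀ i, SimpleGraph (V i)) (p : unitInterval) :
    Matrix (Fin d) (Fin d) ℝ :=
  Matrix.of fun i j => sigma (Γ i) p * sigma (Γ j) p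

/-- The matrix `Σ` is positive semidefinite, so the centred Gaussian measure with covariance
matrix `Σ` is the genuine one. -/
theorem limitCov_posSemidef {d : ℕ} {V : Fin d → Type*} (Γ : ∀ i, SimpleGraph (V i))
    (p : unitInterval) : (limitCov Γ p).PosSemidef := by
  have h := Matrix.posSemidef_vecMulVec_self_star (R := ℝ) (fun i => sigma (Γ i) p)
  have e : limitCov Γ p = Matrix.vecMulVec (fun i => sigma (Γ i) p)
      (star fun i => sigma (Γ i) p) := by
    ext i j
    simp [limitCov, Matrix.vecMulVec_apply]
  rw [e]
  exact h

end SubgraphCLT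

end

/-!
Write `A` for the edge set of `G(n,p)`, and let `ξ_e` be the indicator of the event `e ∈ A`. The
number of copies of `Γ` is, up to the factor `1 / |aut Γ|`, the sum over all injections `φ` of the
vertices of `Γ` into the `n` labels of `∏_{e ∈ Γ} ξ_{φ e}`. Expanding every factor as
`(ξ_{φ e} - p) + p` gives the orthogonal decomposition of the count into products of centred edge
indicators (`normalizedCount_eq`): the empty product is the mean, the products with one factor add
up, by symmetry, to a multiple `edgeCoeff` of `|A| - 𝔼|A|`, and the rest is `remainder`. The
vector of the counts is therefore `(|A| - 𝔼|A|) c + R` with a deterministic vector `c` of order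
`1 / n`, which explains the covariance matrix of rank one. Three errors have to be controlled for a
test function `g`, each by `O(1 / n)`.

* Dropping `R` (`abs_integral_countLaw_sub_le`). Although `R` has the order `n^{-1/2}`, its second
  order effect is bounded by `𝔼 R² = O(1 / n)`, because two copies that share two edges share three
  vertices (`bernoulliExp_remainder_sq_le`). The first order effect
  `𝔼[∂ᵢg((|A| - 𝔼|A|) c) Rᵢ]` is small because averaging `(ξ_e - p)(ξ_f - p) F(|A|)` over `ξ_e` and
  `ξ_f` produces a second difference of `F`, here of order `n⁻²`
  (`abs_bernoulliExp_mul_remainder_le`).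
* Replacing `|A| - 𝔼|A|`, a sum of `n.choose 2` independent variables, by a Gaussian variable of the
  same variance. Lindeberg's exchange argument (`abs_bernoulliExp_sub_gaussian_le`) costs `O(n⁻³)`
  per variable.
* Correcting the standard deviations from their values at `n` to the limits `σ_Γ`
  (`abs_sqrt_mul_edgeCoeff_sub_sigma_le`); test functions are Lipschitz.

Only the partial derivatives of `g` of order at most two are differentiated in directions other than
the coordinate axes; the bound on those of order four makes the ones of order three Lipschitz, which
is what turns partial differentiability into differentiability along lines
(`hasDerivAt_smul_of_partials_lipschitz`). Expectations over `G(n,p)` are handled as finite sums `bernoulliExp`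
over the subsets of the set of potential edges, where independence is the recursion
`bernoulliExp_insert`.
-/

namespace SubgraphCLT

/-! ### Increments of functions with bounded derivatives -/

theorem abs_sub_le_of_hasDerivAt {f f' : ℝ → ℝ} {a b C : ℝ} (hf : ∀ t, HasDerivAt f (f' t) t)
    (hC : ∀ t ∈ Set.uIcc a b, |f' t| ≤ C) : |f b - f a| ≤ C * |b - a| := by
  have := (convex_uIcc a b).norm_image_sub_le_of_norm_hasDerivWithin_le
    (fun t _ => (hf t).hasDerivWithinAt) hC Set.left_mem_uIcc Set.right_mem_uIcc
  simpa [Real.norm_eq_abs] using this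

theorem abs_le_of_mem_uIcc_zero {t y : ℝ} (ht : t ∈ Set.uIcc 0 y) : |t| ≤ |y| := by
  simpa using Set.abs_sub_left_of_mem_uIcc ht

/-- `h` has a second order Taylor expansion at every point, with a remainder of at most
`K |y|³`. Unlike the boundedness of the third derivative, this is a condition that is visibly
stable under averaging translates of `h`. -/
def HasTaylor (K : ℝ) (h : ℝ → ℝ) : Prop :=
  ∃ h₁ h₂ : ℝ → ℝ, ∀ x y, |h (x + y) - h x - y * h₁ x - y ^ 2 / 2 * h₂ x| ≤ K * |y| ^ 3

theorem hasTaylor_of_hasDerivAt {K : ℝ} {h h₁ h₂ h₃ : ℝ → ℝ} (H : ∀ t, HasDerivAt h (h₁ t) t)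
    (H₁ : ∀ t, HasDerivAt h₁ (h₂ t) t) (H₂ : ∀ t, HasDerivAt h₂ (h₃ t) t)
    (H₃ : ∀ t, |h₃ t| ≤ K) : HasTaylor K h := by
  have hK : 0 ≤ K := (abs_nonneg _).trans (H₃ 0)
  refine ⟨h₁, h₂, fun x y => ?_⟩
  have e₂ : ∀ t, |h₂ (x + t) - h₂ x| ≤ K * |t| := fun t => by
    simpa using abs_sub_le_of_hasDerivAt (a := x) (b := x + t) H₂ fun s _ => H₃ s
  have e₁ : ∀ t, |h₁ (x + t) - h₁ x - t * h₂ x| ≤ K * |t| * |t| := fun t => by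
    have := abs_sub_le_of_hasDerivAt (a := 0) (b := t)
      (f := fun s => h₁ (x + s) - h₁ x - s * h₂ x) (f' := fun s => h₂ (x + s) - h₂ x)
      (fun s => by
        simpa using (((H₁ (x + s)).comp_const_add x s).sub_const (h₁ x)).fun_sub
          ((hasDerivAt_id s).mul_const (h₂ x)))
      (C := K * |t|) fun s hs => (e₂ s).trans
        (mul_le_mul_of_nonneg_left (abs_le_of_mem_uIcc_zero hs) hK)
    simpa using this
  have := abs_sub_le_of_hasDerivAt (a := 0) (b := y)
    (f := fun s => h (x + s) - h x - s * h₁ x - s ^ 2 / 2 * h₂ x)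
    (f' := fun s => h₁ (x + s) - h₁ x - s * h₂ x)
    (fun s => by
      simpa using ((((H (x + s)).comp_const_add x s).sub_const (h x)).fun_sub
        ((hasDerivAt_id s).mul_const (h₁ x))).fun_sub
          ((((hasDerivAt_id s).fun_pow 2).div_const 2).mul_const (h₂ x)))
    (C := K * |y| * |y|) fun s hs => (e₁ s).trans (by
      have := abs_le_of_mem_uIcc_zero hs
      gcongr)
  calc _ ≤ K * |y| * |y| * |y| := by simpa using this
    _ = _ := by ring

theorem abs_second_difference_le {K : ℝ} {u u₁ u₂ : ℝ → ℝ} (H : ∀ t, HasDerivAt u (u₁ t) t)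
    (H₁ : ∀ t, HasDerivAt u₁ (u₂ t) t) (H₂ : ∀ t, |u₂ t| ≤ K) (t : ℝ) :
    |u (t + 2) - 2 * u (t + 1) + u t| ≤ K := by
  have e₁ : ∀ s, |u₁ (s + 1) - u₁ s| ≤ K := fun s => by
    simpa using abs_sub_le_of_hasDerivAt (a := s) (b := s + 1) H₁ fun r _ => H₂ r
  have := abs_sub_le_of_hasDerivAt (a := t) (b := t + 1) (f := fun s => u (s + 1) - u s)
    (fun s => ((H (s + 1)).comp_add_const s 1).sub (H s)) fun s _ => e₁ s
  have e : u (t + 1 + 1) - u (t + 1) - (u (t + 1) - u t) = u (t + 2) - 2 * u (t + 1) + u t := by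
    rw [show t + 1 + 1 = t + 2 by ring]; ring
  simpa [e] using this

/-! ### Functions with bounded partial derivatives -/

section Partials

variable {d : ℕ} {f : EuclideanSpace ℝ (Fin d) → ℝ} {F : Fin d → EuclideanSpace ℝ (Fin d) → ℝ}

theorem hasDerivAt_add_smul_single
    (hF : ∀ i x, HasLineDerivAt ℝ f (F i x) x (EuclideanSpace.single i 1)) (i : Fin d)
    (x : EuclideanSpace ℝ (Fin d)) (t : ℝ) :
    HasDerivAt (fun s : ℝ => f (x + s • EuclideanSpace.single i (1 : ℝ)))
      (F i (x + t • EuclideanSpace.single i (1 : ℝ))) t := by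
  have h := hF i (x + t • EuclideanSpace.single i (1 : ℝ))
  rw [HasLineDerivAt] at h
  have h' : HasDerivAt (fun s : ℝ => f (x + t • EuclideanSpace.single i (1 : ℝ) +
      s • EuclideanSpace.single i (1 : ℝ))) (F i (x + t • EuclideanSpace.single i (1 : ℝ)))
      (t - t) := by rwa [sub_self]
  have := h'.comp_sub_const t t
  refine this.congr_of_eventuallyEq (Filter.Eventually.of_forall fun s => ?_)
  simp only [add_assoc, ← add_smul]
  congr 3
  ring

/-- If the partial derivatives of `f` on the box spanned by `x` and `x + v` differ from the
numbers `w i` by at most `C`, then the increment of `f` is linear with slopes `w i` up to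
`C ∑ |v i|`: the coordinates are changed one by one. -/
theorem abs_increment_sub_le
    (hF : ∀ i x, HasLineDerivAt ℝ f (F i x) x (EuclideanSpace.single i 1))
    (x v : EuclideanSpace ℝ (Fin d)) (w : Fin d → ℝ) {C : ℝ}
    (hC : ∀ i, ∀ u : EuclideanSpace ℝ (Fin d), (∀ j, |u j| ≤ |v j|) → |F i (x + u) - w i| ≤ C) :
    |f (x + v) - f x - ∑ i, v i * w i| ≤ C * ∑ i, |v i| := by
  classical
  set V : Finset (Fin d) → EuclideanSpace ℝ (Fin d) :=
    fun s => ∑ i ∈ s, v i • EuclideanSpace.single i (1 : ℝ) with hV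
  have hVj : ∀ s j, V s j = if j ∈ s then v j else 0 := fun s j => by
    simp [hV, WithLp.ofLp_sum, Finset.sum_apply, Pi.single_apply]
  have key : ∀ s : Finset (Fin d),
      |f (x + V s) - f x - ∑ i ∈ s, v i * w i| ≤ C * ∑ i ∈ s, |v i| := fun s => by
    induction s using Finset.induction_on with
    | empty => simp [hV]
    | insert i s hi ih =>
      have hVi : V (insert i s) = V s + v i • EuclideanSpace.single i (1 : ℝ) := by
        simp [hV, Finset.sum_insert hi, add_comm]
      have h := abs_sub_le_of_hasDerivAt (a := 0) (b := v i)
        (f := fun t => f (x + V s + t • EuclideanSpace.single i (1 : ℝ)) - t * w i)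
        (fun t => (hasDerivAt_add_smul_single hF i (x + V s) t).sub
          ((hasDerivAt_id t).mul_const (w i))) (C := C) (fun t ht => by
            rw [add_assoc, one_mul]
            refine hC i _ fun j => ?_
            by_cases hj : j = i
            · subst hj
              simpa [hVj, hi] using abs_le_of_mem_uIcc_zero ht
            · by_cases hjs : j ∈ s <;> simp [hVj, hj, hjs])
      rw [Finset.sum_insert hi, Finset.sum_insert hi, hVi, ← add_assoc]
      simp only [sub_zero, zero_smul, add_zero, zero_mul] at h
      calc _ = |(f (x + V s + v i • EuclideanSpace.single i (1 : ℝ)) - v i * w i - f (x + V s)) +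
              (f (x + V s) - f x - ∑ i ∈ s, v i * w i)| := by congr 1; ring
        _ ≤ _ := (abs_add_le _ _).trans (by rw [mul_add]; exact add_le_add h ih)
  have hVu : V Finset.univ = v := by
    ext j
    simp [hVj]
  simpa [hVu] using key Finset.univ

theorem abs_sub_le_of_partials_le
    (hF : ∀ i x, HasLineDerivAt ℝ f (F i x) x (EuclideanSpace.single i 1))
    (hb : ∀ i x, |F i x| ≤ 1) (x v : EuclideanSpace ℝ (Fin d)) :
    |f (x + v) - f x| ≤ ∑ i, |v i| := by
  simpa using abs_increment_sub_le hF x v 0 (C := 1) fun i u _ => by simpa using hb i (x + u)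

theorem abs_taylor_le_of_partials_lipschitz
    (hF : ∀ i x, HasLineDerivAt ℝ f (F i x) x (EuclideanSpace.single i 1))
    (hl : ∀ i x v, |F i (x + v) - F i x| ≤ ∑ j, |v j|) (x v : EuclideanSpace ℝ (Fin d)) :
    |f (x + v) - f x - ∑ i, v i * F i x| ≤ (∑ i, |v i|) ^ 2 := by
  rw [sq]
  exact abs_increment_sub_le hF x v (F · x) fun i u hu =>
    (hl i x u).trans (Finset.sum_le_sum fun j _ => hu j)

theorem hasDerivAt_smul_of_partials_lipschitz
    (hF : ∀ i x, HasLineDerivAt ℝ f (F i x) x (EuclideanSpace.single i 1))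
    (hl : ∀ i x v, |F i (x + v) - F i x| ≤ ∑ j, |v j|) (v : EuclideanSpace ℝ (Fin d)) (t : ℝ) :
    HasDerivAt (fun s : ℝ => f (s • v)) (∑ i, v i * F i (t • v)) t := by
  rw [hasDerivAt_iff_isLittleO_nhds_zero]
  have hO : (fun s : ℝ => f ((t + s) • v) - f (t • v) - s • ∑ i, v i * F i (t • v)) =O[nhds 0]
      fun s : ℝ => s ^ 2 := by
    refine Asymptotics.IsBigO.of_bound ((∑ i, |v i|) ^ 2) (Filter.Eventually.of_forall fun s => ?_)
    have := abs_taylor_le_of_partials_lipschitz hF hl (t • v) (s • v)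
    simp only [← add_smul, PiLp.smul_apply, smul_eq_mul, abs_mul, ← Finset.mul_sum, mul_assoc,
      mul_pow, sq_abs] at this
    rw [Real.norm_eq_abs, smul_eq_mul, norm_pow, Real.norm_eq_abs, sq_abs, mul_comm _ (s ^ 2)]
    exact this
  refine hO.trans_isLittleO ?_
  simpa using Asymptotics.isLittleO_pow_pow (𝕜 := ℝ) (m := 1) (n := 2) (by norm_num)

theorem abs_sum_mul_le {v w : Fin d → ℝ} {C : ℝ} (h : ∀ i, |w i| ≤ C) :
    |∑ i, v i * w i| ≤ (∑ i, |v i|) * C := by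
  rw [Finset.sum_mul]
  refine (Finset.abs_sum_le_sum_abs _ _).trans (Finset.sum_le_sum fun i _ => ?_)
  rw [abs_mul]
  exact mul_le_mul_of_nonneg_left (h i) (abs_nonneg _)

end Partials

/-! ### The test functions of the `d₄`-distance -/

section TestFunctions

variable {d : ℕ} {g : EuclideanSpace ℝ (Fin d) → ℝ}

theorem abs_iterPartialDeriv_le (hg : g ∈ testFunctions d) {l : List (Fin d)}
    (h1 : 1 ≤ l.length) (h4 : l.length ≤ 4) (x : EuclideanSpace ℝ (Fin d)) :
    |iterPartialDeriv l g x| ≤ 1 := by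
  obtain ⟨-, H1, H2, H3, H4⟩ := hg
  have hM : M l.length g ≤ 1 := by
    obtain h | h | h | h : l.length = 1 ∨ l.length = 2 ∨ l.length = 3 ∨ l.length = 4 := by omega
    all_goals rw [h]; assumption
  have : ‖iterPartialDeriv l g x‖ₑ ≤ 1 := by
    refine le_trans ?_ hM
    exact (le_iSup (fun y => ‖iterPartialDeriv l g y‖ₑ) x).trans
      (le_iSup₂_of_le (f := fun (k : List (Fin d)) (_ : k.length = l.length) =>
        ⨆ y, ‖iterPartialDeriv k g y‖ₑ) l rfl le_rfl)
  rw [← Real.norm_eq_abs]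
  rw [← ofReal_norm] at this
  exact ENNReal.ofReal_le_one.1 this

theorem hasLineDerivAt_iterPartialDeriv (hg : g ∈ testFunctions d) {l : List (Fin d)}
    (hl : l.length ≤ 3) (i : Fin d) (x : EuclideanSpace ℝ (Fin d)) :
    HasLineDerivAt ℝ (iterPartialDeriv l g) (iterPartialDeriv (i :: l) g x) x
      (EuclideanSpace.single i 1) :=
  (hg.1 l (by omega) i x).hasLineDerivAt

theorem iterPartialDeriv_lipschitz (hg : g ∈ testFunctions d) {l : List (Fin d)}
    (hl : l.length ≤ 3) (x v : EuclideanSpace ℝ (Fin d)) :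
    |iterPartialDeriv l g (x + v) - iterPartialDeriv l g x| ≤ ∑ i, |v i| :=
  abs_sub_le_of_partials_le (hasLineDerivAt_iterPartialDeriv hg hl)
    (fun i y => abs_iterPartialDeriv_le hg (by simp) (by simp; omega) y) x v

theorem testFunction_lipschitz (hg : g ∈ testFunctions d) (x y : EuclideanSpace ℝ (Fin d)) :
    |g x - g y| ≤ ∑ i, |x i - y i| := by
  simpa [iterPartialDeriv] using iterPartialDeriv_lipschitz hg (l := []) (by simp) y (x - y)

theorem testFunction_taylor (hg : g ∈ testFunctions d) (x v : EuclideanSpace ℝ (Fin d)) :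
    |g (x + v) - g x - ∑ i, v i * partialDeriv i g x| ≤ (∑ i, |v i|) ^ 2 :=
  abs_taylor_le_of_partials_lipschitz (hasLineDerivAt_iterPartialDeriv hg (l := []) (by simp))
    (fun i => iterPartialDeriv_lipschitz hg (l := [i]) (by simp)) x v

theorem hasDerivAt_iterPartialDeriv_smul (hg : g ∈ testFunctions d) {l : List (Fin d)}
    (hl : l.length ≤ 2) (v : EuclideanSpace ℝ (Fin d)) (t : ℝ) :
    HasDerivAt (fun s : ℝ => iterPartialDeriv l g (s • v))
      (∑ i, v i * iterPartialDeriv (i :: l) g (t • v)) t :=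
  hasDerivAt_smul_of_partials_lipschitz (hasLineDerivAt_iterPartialDeriv hg (by omega))
    (fun i => iterPartialDeriv_lipschitz hg (by simp; omega)) v t

theorem hasTaylor_testFunction_smul (hg : g ∈ testFunctions d) (v : EuclideanSpace ℝ (Fin d)) :
    HasTaylor ((∑ i, |v i|) ^ 3) fun t : ℝ => g (t • v) := by
  refine hasTaylor_of_hasDerivAt (hasDerivAt_iterPartialDeriv_smul hg (l := []) (by simp) v)
    (h₂ := fun t => ∑ i, v i * ∑ j, v j * iterPartialDeriv [j, i] g (t • v))
    (h₃ := fun t => ∑ i, v i * ∑ j, v j * ∑ k, v k * iterPartialDeriv [k, j, i] g (t • v))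
    (fun t => .fun_sum fun i _ => (hasDerivAt_iterPartialDeriv_smul hg (l := [i]) (by simp) v
      t).const_mul _)
    (fun t => .fun_sum fun i _ => .const_mul _ <| .fun_sum fun j _ => .const_mul _ <|
      hasDerivAt_iterPartialDeriv_smul hg (l := [j, i]) (by simp) v t) fun t => ?_
  refine (abs_sum_mul_le fun i => abs_sum_mul_le fun j => abs_sum_mul_le fun k =>
    abs_iterPartialDeriv_le hg (l := [k, j, i]) (by simp) (by simp) _).trans_eq ?_
  ring

theorem abs_second_difference_partialDeriv_le (hg : g ∈ testFunctions d) (i : Fin d)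
    (v : EuclideanSpace ℝ (Fin d)) (t : ℝ) :
    |partialDeriv i g ((t + 2) • v) - 2 * partialDeriv i g ((t + 1) • v) +
      partialDeriv i g (t • v)| ≤ (∑ i, |v i|) ^ 2 := by
  refine abs_second_difference_le (u := fun t : ℝ => partialDeriv i g (t • v))
    (hasDerivAt_iterPartialDeriv_smul hg (l := [i]) (by simp) v)
    (u₂ := fun t => ∑ j, v j * ∑ k, v k * iterPartialDeriv [k, j, i] g (t • v))
    (fun t => .fun_sum fun j _ => .const_mul _ <|
      hasDerivAt_iterPartialDeriv_smul hg (l := [j, i]) (by simp) v t) (fun t => ?_) t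
  refine (abs_sum_mul_le fun j => abs_sum_mul_le fun k =>
    abs_iterPartialDeriv_le hg (l := [k, j, i]) (by simp) (by simp) _).trans_eq ?_
  ring

theorem continuous_testFunction (hg : g ∈ testFunctions d) : Continuous g := by
  refine continuous_iff_continuousAt.2 fun x => ?_
  rw [ContinuousAt, tendsto_iff_norm_sub_tendsto_zero]
  refine squeeze_zero (fun _ => norm_nonneg _) (fun y => testFunction_lipschitz hg y x) ?_
  have : Continuous fun y : EuclideanSpace ℝ (Fin d) => ∑ i, |y i - x i| := by fun_prop
  simpa using this.tendsto x

end TestFunctions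

/-! ### Expectations over a binomial random subset -/

section BernoulliExp

variable {ι : Type*}

/-- The expectation of `f A`, where `A` is the random subset of `D` that contains every element
of `D` independently with probability `p`. -/
def bernoulliExp (p : ℝ) (D : Finset ι) (f : Finset ι → ℝ) : ℝ :=
  ∑ A ∈ D.powerset, p ^ A.card * (1 - p) ^ (D.card - A.card) * f A

/-- The product over `e ∈ B` of the centred indicators of the events `e ∈ A`. -/
def centredProd [DecidableEq ι] (p : ℝ) (B A : Finset ι) : ℝ :=
  ∏ e ∈ B, ((if e ∈ A then 1 else 0) - p)

variable {p : ℝ} {D : Finset ι} {f g : Finset ι → ℝ}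

theorem bernoulliExp_congr (h : ∀ A ⊆ D, f A = g A) : bernoulliExp p D f = bernoulliExp p D g :=
  Finset.sum_congr rfl fun A hA => by rw [h A (Finset.mem_powerset.1 hA)]

theorem bernoulliExp_sub : bernoulliExp p D (fun A => f A - g A) =
    bernoulliExp p D f - bernoulliExp p D g := by
  simp [bernoulliExp, mul_sub, Finset.sum_sub_distrib]

theorem bernoulliExp_const_mul (c : ℝ) : bernoulliExp p D (fun A => c * f A) =
    c * bernoulliExp p D f := by
  simp only [bernoulliExp, Finset.mul_sum]
  exact Finset.sum_congr rfl fun A _ => by ring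

theorem bernoulliExp_sum {κ : Type*} (s : Finset κ) (F : κ → Finset ι → ℝ) :
    bernoulliExp p D (fun A => ∑ k ∈ s, F k A) = ∑ k ∈ s, bernoulliExp p D (F k) := by
  simp only [bernoulliExp, Finset.mul_sum]
  exact Finset.sum_comm

theorem bernoulliExp_const (c : ℝ) : bernoulliExp p D (fun _ => c) = c := by
  rw [bernoulliExp, ← Finset.sum_mul, Finset.sum_pow_mul_eq_add_pow]
  simp

theorem abs_bernoulliExp_le_of_le (h0 : 0 ≤ p) (h1 : p ≤ 1) (h : ∀ A ⊆ D, |f A| ≤ g A) :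
    |bernoulliExp p D f| ≤ bernoulliExp p D g := by
  refine (Finset.abs_sum_le_sum_abs _ _).trans (Finset.sum_le_sum fun A hA => ?_)
  have hw : 0 ≤ p ^ A.card * (1 - p) ^ (D.card - A.card) :=
    mul_nonneg (pow_nonneg h0 _) (pow_nonneg (sub_nonneg.2 h1) _)
  rw [abs_mul, abs_of_nonneg hw]
  exact mul_le_mul_of_nonneg_left (h A (Finset.mem_powerset.1 hA)) hw

theorem abs_bernoulliExp_le (h0 : 0 ≤ p) (h1 : p ≤ 1) {C : ℝ} (h : ∀ A ⊆ D, |f A| ≤ C) :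
    |bernoulliExp p D f| ≤ C :=
  (abs_bernoulliExp_le_of_le h0 h1 h).trans_eq (bernoulliExp_const C)

variable [DecidableEq ι]

theorem bernoulliExp_insert {e : ι} (he : e ∉ D) : bernoulliExp p (insert e D) f =
    bernoulliExp p D fun A => p * f (insert e A) + (1 - p) * f A := by
  rw [bernoulliExp, Finset.sum_powerset_insert he, bernoulliExp, ← Finset.sum_add_distrib]
  refine Finset.sum_congr rfl fun A hA => ?_
  have hA := Finset.mem_powerset.1 hA
  have hc := Finset.card_le_card hA
  rw [Finset.card_insert_of_notMem he, Finset.card_insert_of_notMem fun h => he (hA h),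
    Nat.add_sub_add_right, Nat.succ_sub hc, pow_succ, pow_succ]
  ring

theorem bernoulliExp_erase {e : ι} (he : e ∈ D) : bernoulliExp p D f =
    bernoulliExp p (D.erase e) fun A => p * f (insert e A) + (1 - p) * f A := by
  rw [← bernoulliExp_insert (Finset.notMem_erase e D), Finset.insert_erase he]

theorem bernoulliExp_centred_mul_eq_zero {e : ι} (he : e ∈ D) (hf : ∀ A, f (insert e A) = f A) :
    bernoulliExp p D (fun A => ((if e ∈ A then 1 else 0) - p) * f A) = 0 := by
  rw [bernoulliExp_erase he]
  refine (bernoulliExp_congr fun A hA => ?_).trans (bernoulliExp_const 0)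
  have : e ∉ A := fun h => Finset.notMem_erase e D (hA h)
  rw [hf, if_pos (Finset.mem_insert_self e A), if_neg this]
  ring

theorem abs_centredProd_le (h0 : 0 ≤ p) (h1 : p ≤ 1) (B A : Finset ι) :
    |centredProd p B A| ≤ 1 := by
  rw [centredProd, Finset.abs_prod]
  refine Finset.prod_le_one (fun _ _ => abs_nonneg _) fun e _ => ?_
  split_ifs <;> rw [abs_le] <;> constructor <;> linarith

theorem centredProd_insert_right {e : ι} {B : Finset ι} (he : e ∉ B) (A : Finset ι) :
    centredProd p B (insert e A) = centredProd p B A :=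
  Finset.prod_congr rfl fun x hx => by
    have : x ≠ e := fun h => he (h ▸ hx)
    simp [this]

theorem centredProd_eq_mul_erase {e : ι} {B : Finset ι} (he : e ∈ B) (A : Finset ι) :
    centredProd p B A = ((if e ∈ A then 1 else 0) - p) * centredProd p (B.erase e) A :=
  (Finset.mul_prod_erase B _ he).symm

/-- Distinct products of centred indicators are uncorrelated. -/
theorem bernoulliExp_centredProd_mul_centredProd {B C : Finset ι} (hB : B ⊆ D) (hC : C ⊆ D)
    (h : B ≠ C) : bernoulliExp p D (fun A => centredProd p B A * centredProd p C A) = 0 := by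
  have key : ∀ {B C : Finset ι}, B ⊆ D → (∃ e ∈ B, e ∉ C) →
      bernoulliExp p D (fun A => centredProd p B A * centredProd p C A) = 0 := by
    rintro B C hB ⟨e, heB, heC⟩
    rw [← bernoulliExp_centred_mul_eq_zero (p := p) (hB heB)
      (f := fun A => centredProd p (B.erase e) A * centredProd p C A) fun A => by
        rw [centredProd_insert_right (Finset.notMem_erase e B), centredProd_insert_right heC]]
    exact bernoulliExp_congr fun A _ => by rw [centredProd_eq_mul_erase heB]; ring
  by_cases hBC : B ⊆ C
  · obtain ⟨e, he, he'⟩ := Finset.not_subset.1 fun h' => h (hBC.antisymm h')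
    rw [← key hC ⟨e, he, he'⟩]
    exact bernoulliExp_congr fun A _ => mul_comm _ _
  · exact key hB (Finset.not_subset.1 hBC)

theorem bernoulliExp_centredProd {B : Finset ι} (hB : B ⊆ D) (h : B.Nonempty) :
    bernoulliExp p D (centredProd p B) = 0 := by
  rw [← bernoulliExp_centredProd_mul_centredProd (p := p) hB (Finset.empty_subset D) h.ne_empty]
  exact bernoulliExp_congr fun A _ => by simp [centredProd]

theorem abs_bernoulliExp_centredProd_mul_centredProd_le (h0 : 0 ≤ p) (h1 : p ≤ 1)
    {B C : Finset ι} (hB : B ⊆ D) (hC : C ⊆ D) :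
    |bernoulliExp p D (fun A => centredProd p B A * centredProd p C A)| ≤
      if B = C then 1 else 0 := by
  split_ifs with h
  · refine abs_bernoulliExp_le h0 h1 fun A _ => ?_
    rw [abs_mul]
    exact mul_le_one₀ (abs_centredProd_le h0 h1 _ _) (abs_nonneg _) (abs_centredProd_le h0 h1 _ _)
  · rw [bernoulliExp_centredProd_mul_centredProd hB hC h, abs_zero]

/-- A product of at least two centred indicators is almost uncorrelated with a smooth function of
the number of elements: averaging over two elements of `B` leaves a second difference. -/
theorem abs_bernoulliExp_centredProd_mul_card_le (h0 : 0 ≤ p) (h1 : p ≤ 1) {B : Finset ι}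
    (hB : B ⊆ D) (hB2 : 2 ≤ B.card) {F : ℕ → ℝ} {K : ℝ}
    (hF : ∀ k, |F (k + 2) - 2 * F (k + 1) + F k| ≤ K) :
    |bernoulliExp p D (fun A => centredProd p B A * F A.card)| ≤ K := by
  obtain ⟨a, ha, b, hb, hab⟩ := Finset.one_lt_card.1 hB2
  have hbD : b ∈ D.erase a := Finset.mem_erase.2 ⟨hab.symm, hB hb⟩
  have hbB : b ∈ B.erase a := Finset.mem_erase.2 ⟨hab.symm, hb⟩
  rw [bernoulliExp_erase (hB ha), bernoulliExp_erase hbD]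
  refine abs_bernoulliExp_le h0 h1 fun A hA => ?_
  have haA : a ∉ A := fun h => by simpa using hA h
  have hbA : b ∉ A := fun h => by simpa using hA h
  set χ := centredProd p ((B.erase a).erase b) A with hχ
  -- split off the factors of `a` and `b`; the others, `χ`, are the same for all four outcomes
  have e₁ : ∀ A', centredProd p B A' = ((if a ∈ A' then 1 else 0) - p) *
      (((if b ∈ A' then 1 else 0) - p) * centredProd p ((B.erase a).erase b) A') := fun A' => by
    rw [centredProd_eq_mul_erase ha, centredProd_eq_mul_erase hbB]
  have ea : ∀ A', centredProd p ((B.erase a).erase b) (insert a A') =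
      centredProd p ((B.erase a).erase b) A' := centredProd_insert_right (by simp)
  have eb : ∀ A', centredProd p ((B.erase a).erase b) (insert b A') =
      centredProd p ((B.erase a).erase b) A' := centredProd_insert_right (by simp)
  have c₂ : (insert a (insert b A)).card = A.card + 2 := by
    rw [Finset.card_insert_of_notMem (by simp [hab, haA]), Finset.card_insert_of_notMem hbA]
  have ca : (insert a A).card = A.card + 1 := Finset.card_insert_of_notMem haA
  have cb : (insert b A).card = A.card + 1 := Finset.card_insert_of_notMem hbA
  simp only [e₁, ea, eb, c₂, ca, cb, Finset.mem_insert, or_true, haA, hbA, hab, hab.symm,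
    or_false, if_true, if_false, ← hχ]
  calc _ = |((p * (1 - p)) ^ 2 * χ) * (F (A.card + 2) - 2 * F (A.card + 1) + F A.card)| := by
        congr 1; ring
    _ = |(p * (1 - p)) ^ 2 * χ| * |F (A.card + 2) - 2 * F (A.card + 1) + F A.card| := abs_mul _ _
    _ ≤ 1 * K := by
        refine mul_le_mul ?_ (hF _) (abs_nonneg _) zero_le_one
        rw [abs_mul, abs_of_nonneg (sq_nonneg _)]
        have hp : p * (1 - p) ≤ 1 := mul_le_one₀ h1 (by linarith) (by linarith)
        exact mul_le_one₀ (pow_le_one₀ (mul_nonneg h0 (by linarith)) hp) (abs_nonneg _)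
          (abs_centredProd_le h0 h1 _ _)
    _ = K := one_mul K

end BernoulliExp

/-! ### Replacing Bernoulli variables by Gaussian ones -/

section Lindeberg

theorem HasTaylor.continuous {K : ℝ} {h : ℝ → ℝ} (hh : HasTaylor K h) : Continuous h := by
  obtain ⟨h₁, h₂, H⟩ := hh
  refine continuous_iff_continuousAt.2 fun x => ?_
  rw [ContinuousAt, tendsto_iff_norm_sub_tendsto_zero]
  have hc : Continuous fun z : ℝ =>
      K * |z - x| ^ 3 + |(z - x) * h₁ x + (z - x) ^ 2 / 2 * h₂ x| := by fun_prop
  refine squeeze_zero (fun _ => norm_nonneg _) (fun z => ?_) (by simpa using hc.tendsto x)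
  have := H x (z - x)
  rw [add_sub_cancel] at this
  rw [Real.norm_eq_abs]
  calc _ = |(h z - h x - (z - x) * h₁ x - (z - x) ^ 2 / 2 * h₂ x) +
        ((z - x) * h₁ x + (z - x) ^ 2 / 2 * h₂ x)| := by congr 1; ring
    _ ≤ _ := (abs_add_le _ _).trans (by gcongr)

theorem HasTaylor.comp_const_add {K : ℝ} {h : ℝ → ℝ} (hh : HasTaylor K h) (c : ℝ) :
    HasTaylor K fun t => h (c + t) := by
  obtain ⟨h₁, h₂, H⟩ := hh
  exact ⟨fun t => h₁ (c + t), fun t => h₂ (c + t), fun x y => by simpa [add_assoc] using H (c + x) y⟩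

theorem HasTaylor.average {K p : ℝ} {h k : ℝ → ℝ} (hh : HasTaylor K h) (hk : HasTaylor K k)
    (h0 : 0 ≤ p) (h1 : p ≤ 1) : HasTaylor K fun t => p * h t + (1 - p) * k t := by
  obtain ⟨h₁, h₂, H⟩ := hh
  obtain ⟨k₁, k₂, H'⟩ := hk
  refine ⟨fun t => p * h₁ t + (1 - p) * k₁ t, fun t => p * h₂ t + (1 - p) * k₂ t, fun x y => ?_⟩
  have a := mul_le_mul_of_nonneg_left (H x y) h0
  have b := mul_le_mul_of_nonneg_left (H' x y) (sub_nonneg.2 h1)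
  rw [← abs_of_nonneg h0, ← abs_mul] at a
  rw [← abs_of_nonneg (sub_nonneg.2 h1), ← abs_mul] at b
  rw [abs_of_nonneg h0] at a
  rw [abs_of_nonneg (sub_nonneg.2 h1)] at b
  calc _ = |p * (h (x + y) - h x - y * h₁ x - y ^ 2 / 2 * h₂ x) +
        (1 - p) * (k (x + y) - k x - y * k₁ x - y ^ 2 / 2 * k₂ x)| := by congr 1; ring
    _ ≤ p * (K * |y| ^ 3) + (1 - p) * (K * |y| ^ 3) := (abs_add_le _ _).trans (add_le_add a b)
    _ = _ := by ring

theorem integrable_pow_gaussianReal (v : NNReal) (k : ℕ) :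
    Integrable (fun x : ℝ => x ^ k) (gaussianReal 0 v) := by
  have := (memLp_id_gaussianReal (μ := 0) (v := v) k).integrable_norm_pow'
  refine (integrable_norm_iff (by fun_prop)).1 ?_
  simpa using this

theorem HasTaylor.integrable {K : ℝ} {h : ℝ → ℝ} (hh : HasTaylor K h) (v : NNReal) :
    Integrable h (gaussianReal 0 v) := by
  have hc := hh.continuous
  obtain ⟨h₁, h₂, H⟩ := hh
  have i₁ := integrable_pow_gaussianReal v 1
  have i₂ := integrable_pow_gaussianReal v 2
  have i₃ := (integrable_pow_gaussianReal v 3).norm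
  have hi : Integrable (fun y : ℝ => K * |y| ^ 3 + |h 0 + y ^ 1 * h₁ 0 + y ^ 2 * (h₂ 0 / 2)|)
      (gaussianReal 0 v) := by
    have := (i₃.const_mul K).add
      ((((integrable_const (h 0)).add (i₁.mul_const (h₁ 0))).add (i₂.mul_const (h₂ 0 / 2))).norm)
    simpa [Pi.add_def] using this
  refine hi.mono' hc.aestronglyMeasurable (Filter.Eventually.of_forall fun y => ?_)
  have := H 0 y
  rw [zero_add] at this
  rw [Real.norm_eq_abs]
  calc _ = |(h y - h 0 - y * h₁ 0 - y ^ 2 / 2 * h₂ 0) +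
        (h 0 + y ^ 1 * h₁ 0 + y ^ 2 * (h₂ 0 / 2))| := by congr 1; ring
    _ ≤ _ := (abs_add_le _ _).trans (by gcongr)

/-- One step of the replacement: a centred Bernoulli variable and a centred Gaussian variable have
the same first two moments. -/
theorem abs_bernoulli_sub_gaussian_le {K p : ℝ} {h : ℝ → ℝ} (hh : HasTaylor K h)
    (h0 : 0 ≤ p) (h1 : p ≤ 1) {v : NNReal} (hv : (v : ℝ) = p * (1 - p)) (x : ℝ) :
    |p * h (x + (1 - p)) + (1 - p) * h (x + -p) - ∫ y, h (x + y) ∂gaussianReal 0 v| ≤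
      K * (1 + ∫ y, |y| ^ 3 ∂gaussianReal 0 v) := by
  have hint := (hh.comp_const_add x).integrable v
  obtain ⟨h₁, h₂, H⟩ := hh
  have hK : 0 ≤ K := by simpa using (abs_nonneg _).trans (H 0 1)
  have i₁ := integrable_pow_gaussianReal v 1
  have i₂ := integrable_pow_gaussianReal v 2
  have i₃ := (integrable_pow_gaussianReal v 3).norm
  simp only [norm_pow, Real.norm_eq_abs, pow_one] at i₁ i₃
  have m₁ : ∫ y, y ∂gaussianReal 0 v = 0 := integral_id_gaussianReal
  have m₂ : ∫ y, y ^ 2 ∂gaussianReal 0 v = v := by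
    have := variance_fun_id_gaussianReal (μ := 0) (v := v)
    rwa [variance_of_integral_eq_zero (by fun_prop) m₁] at this
  have hG : |(∫ y, h (x + y) ∂gaussianReal 0 v) - (h x + v / 2 * h₂ x)| ≤
      K * ∫ y, |y| ^ 3 ∂gaussianReal 0 v := by
    have e : (∫ y, h (x + y) ∂gaussianReal 0 v) - (h x + v / 2 * h₂ x) =
        ∫ y, (h (x + y) - h x - y * h₁ x - y ^ 2 / 2 * h₂ x) ∂gaussianReal 0 v := by
      rw [integral_sub, integral_sub, integral_sub hint (integrable_const _), integral_mul_const,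
        integral_mul_const, integral_div, m₁, m₂]
      · simp; ring
      · exact hint.sub (integrable_const _)
      · exact i₁.mul_const _
      · exact (hint.sub (integrable_const _)).sub (i₁.mul_const _)
      · exact (i₂.div_const 2).mul_const _
    rw [e, ← integral_const_mul]
    refine (abs_integral_le_integral_abs).trans (integral_mono_of_nonneg
      (Filter.Eventually.of_forall fun _ => abs_nonneg _) (i₃.const_mul K)
      (Filter.Eventually.of_forall fun y => H x y))
  have hB : |p * h (x + (1 - p)) + (1 - p) * h (x + -p) - (h x + v / 2 * h₂ x)| ≤ K := by
    have a := mul_le_mul_of_nonneg_left (H x (1 - p)) h0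
    have b := mul_le_mul_of_nonneg_left (H x (-p)) (sub_nonneg.2 h1)
    have hq : |1 - p| ^ 3 ≤ 1 := by
      rw [abs_of_nonneg (by linarith)]; exact pow_le_one₀ (by linarith) (by linarith)
    have hp : |-p| ^ 3 ≤ 1 := by
      rw [abs_neg, abs_of_nonneg h0]; exact pow_le_one₀ h0 h1
    calc _ = |p * (h (x + (1 - p)) - h x - (1 - p) * h₁ x - (1 - p) ^ 2 / 2 * h₂ x) +
          (1 - p) * (h (x + -p) - h x - -p * h₁ x - (-p) ^ 2 / 2 * h₂ x)| := by
          rw [hv]; congr 1; ring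
      _ ≤ p * (K * |1 - p| ^ 3) + (1 - p) * (K * |-p| ^ 3) := by
          refine (abs_add_le _ _).trans (add_le_add ?_ ?_)
          · rwa [abs_mul, abs_of_nonneg h0]
          · rwa [abs_mul, abs_of_nonneg (sub_nonneg.2 h1)]
      _ ≤ p * (K * 1) + (1 - p) * (K * 1) := by
          have : 0 ≤ 1 - p := sub_nonneg.2 h1
          gcongr
      _ = K := by ring
  rw [abs_sub_comm] at hG
  calc _ = _ := by rw [← sub_add_sub_cancel _ (h x + v / 2 * h₂ x)]
    _ ≤ K + K * ∫ y, |y| ^ 3 ∂gaussianReal 0 v := (abs_add_le _ _).trans (add_le_add hB hG)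
    _ = _ := by ring

/-- Lindeberg's replacement argument: the variables are exchanged one at a time. -/
theorem abs_bernoulliExp_sub_gaussian_le {ι : Type*} [DecidableEq ι] {K p : ℝ} (h0 : 0 ≤ p)
    (h1 : p ≤ 1) {v : NNReal} (hv : (v : ℝ) = p * (1 - p)) (D : Finset ι) {h : ℝ → ℝ}
    (hh : HasTaylor K h) :
    |bernoulliExp p D (fun A => h (A.card - p * D.card)) -
      ∫ y, h y ∂gaussianReal 0 (D.card * v)| ≤
      D.card * (K * (1 + ∫ y, |y| ^ 3 ∂gaussianReal 0 v)) := by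
  set m := ∫ y, |y| ^ 3 ∂gaussianReal 0 v
  induction D using Finset.induction_on generalizing h with
  | empty => simp [bernoulliExp, gaussianReal_zero_var]
  | insert e D he ih =>
    have hP : HasTaylor K fun t => p * h ((1 - p) + t) + (1 - p) * h (-p + t) :=
      (hh.comp_const_add _).average (hh.comp_const_add _) h0 h1
    have hconv : gaussianReal 0 ((insert e D).card * v) =
        Measure.conv (gaussianReal 0 (D.card * v)) (gaussianReal 0 v) := by
      rw [gaussianReal_conv_gaussianReal, Finset.card_insert_of_notMem he]
      congr 1
      · simp
      · push_cast; ring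
    have hint : Integrable h (Measure.conv (gaussianReal 0 (D.card * v)) (gaussianReal 0 v)) :=
      hconv ▸ hh.integrable _
    have hint' : Integrable (fun x => ∫ y, h (x + y) ∂gaussianReal 0 v)
        (gaussianReal 0 (D.card * v)) :=
      ((integrable_map_measure hint.aestronglyMeasurable (by fun_prop)).1 hint).integral_prod_left
    have hE : bernoulliExp p (insert e D) (fun A => h (A.card - p * (insert e D).card)) =
        bernoulliExp p D (fun A => p * h ((1 - p) + (A.card - p * D.card)) +
          (1 - p) * h (-p + (A.card - p * D.card))) := by
      rw [bernoulliExp_insert he]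
      refine bernoulliExp_congr fun A hA => ?_
      rw [Finset.card_insert_of_notMem he, Finset.card_insert_of_notMem fun h => he (hA h)]
      congr 3 <;> push_cast <;> ring
    have step : |(∫ x, (p * h ((1 - p) + x) + (1 - p) * h (-p + x)) ∂gaussianReal 0 (D.card * v)) -
        ∫ x, ∫ y, h (x + y) ∂gaussianReal 0 v ∂gaussianReal 0 (D.card * v)| ≤ K * (1 + m) := by
      rw [← integral_sub (hP.integrable _) hint', ← Real.norm_eq_abs]
      refine (norm_integral_le_of_norm_le_const (C := K * (1 + m))
        (Filter.Eventually.of_forall fun x => ?_)).trans (by simp)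
      rw [Real.norm_eq_abs, add_comm (1 - p) x, add_comm (-p) x]
      exact abs_bernoulli_sub_gaussian_le hh h0 h1 hv x
    rw [hE, hconv, integral_conv hint, Finset.card_insert_of_notMem he]
    refine (abs_sub_le _ (∫ x, (p * h ((1 - p) + x) + (1 - p) * h (-p + x))
      ∂gaussianReal 0 (D.card * v)) _).trans ((add_le_add (ih hP) step).trans_eq ?_)
    push_cast
    ring

end Lindeberg

/-! ### Counting copies of a graph -/

section Copies

variable {V W : Type*} (Γ : SimpleGraph V) (G : SimpleGraph W)

/-- A copy of `Γ` in `G` is the same as a subgraph of `G` together with an isomorphism from `Γ`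
to it. -/
theorem bijective_sigma_iso_toCopy :
    Function.Bijective (fun x : (Σ S : G.Subgraph, (Γ ≃g S.coe)) =>
      (SimpleGraph.Subgraph.coeCopy x.1).comp x.2.toCopy) := by
  constructor
  · rintro ⟨S, e⟩ ⟨S', e'⟩ h
    have key : ∀ (S : G.Subgraph) (e : Γ ≃g S.coe),
        ((SimpleGraph.Subgraph.coeCopy S).comp e.toCopy).toSubgraph = S := fun S e => by
      ext x y
      · simp only [SimpleGraph.Subgraph.map_verts, SimpleGraph.Subgraph.verts_top, Set.image_univ,
          Set.mem_range]
        exact ⟨by rintro ⟨a, rfl⟩; exact (e a).2, fun hx => ⟨e.symm ⟨x, hx⟩, by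
          change ((e (e.symm ⟨x, hx⟩) : S.verts) : W) = x
          simp⟩⟩
      · simp only [SimpleGraph.Subgraph.map_adj, Relation.Map, SimpleGraph.Subgraph.top_adj]
        constructor
        · rintro ⟨a, b, hab, rfl, rfl⟩
          exact e.map_adj_iff.2 hab
        · intro hxy
          refine ⟨e.symm ⟨x, hxy.fst_mem⟩, e.symm ⟨y, hxy.snd_mem⟩, e.symm.map_adj_iff.2 hxy, ?_, ?_⟩
          · change ((e (e.symm ⟨x, _⟩) : S.verts) : W) = x
            simp
          · change ((e (e.symm ⟨y, _⟩) : S.verts) : W) = y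
            simp
    have hS : S = S' := by
      rw [← key S e, ← key S' e']
      exact congrArg _ h
    subst hS
    congr 1
    ext a
    exact congrArg (fun f : SimpleGraph.Copy Γ G => f a) h
  · intro f
    exact ⟨⟨f.toSubgraph, f.isoToSubgraph⟩, by ext a; rfl⟩

theorem copyCount_mul_card_aut [Fintype V] [Fintype W] :
    G.copyCount Γ * Nat.card (Γ ≃g Γ) = Nat.card (SimpleGraph.Copy Γ G) := by
  classical
  have hfib : ∀ S : G.Subgraph, Nat.card (Γ ≃g S.coe) =
      if Nonempty (Γ ≃g S.coe) then Nat.card (Γ ≃g Γ) else 0 := fun S => by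
    split_ifs with h
    · obtain ⟨e⟩ := h
      exact Nat.card_congr ⟨fun f => f.trans e.symm, fun f => f.trans e,
        fun f => by ext; simp, fun f => by ext; simp⟩
    · exact Nat.card_eq_zero.2 (Or.inl (not_nonempty_iff.1 h))
  have : ∀ S : G.Subgraph, Finite (Γ ≃g S.coe) := fun S =>
    Finite.of_injective (fun f : Γ ≃g S.coe => (f : V → S.verts)) DFunLike.coe_injective
  rw [← Nat.card_eq_of_bijective _ (bijective_sigma_iso_toCopy Γ G), Nat.card_sigma,
    Finset.sum_congr rfl fun S _ => hfib S, ← Finset.sum_filter, Finset.sum_const,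
    smul_eq_mul, SimpleGraph.copyCount]

/-- The edges of a finite graph, as a finset. -/
noncomputable def edges [Finite V] : Finset (Sym2 V) := Γ.edgeSet.toFinite.toFinset

theorem mem_edges [Finite V] {e : Sym2 V} : e ∈ edges Γ ↔ e ∈ Γ.edgeSet := by simp [edges]

theorem card_edges [Finite V] : (edges Γ).card = Γ.edgeSet.ncard :=
  (Set.ncard_eq_toFinset_card _ _).symm

open scoped Classical in
theorem card_copy_eq_sum [Fintype V] [Fintype W] :
    (Nat.card (SimpleGraph.Copy Γ G) : ℝ) =
      ∑ φ : V ↪ W, ∏ e ∈ edges Γ, if φ.sym2Map e ∈ G.edgeSet then (1 : ℝ) else 0 := by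
  have e : SimpleGraph.Copy Γ G ≃ {φ : V ↪ W // ∀ e ∈ edges Γ, φ.sym2Map e ∈ G.edgeSet} :=
    { toFun := fun f => ⟨f.toEmbedding, fun e he => by
        induction e using Sym2.ind with
        | _ a b => exact f.toHom.map_adj ((mem_edges Γ).1 he)⟩
      invFun := fun φ => ⟨⟨φ.1, fun {a b} hab =>
        φ.2 s(a, b) ((mem_edges Γ).2 hab)⟩, φ.1.injective⟩
      left_inv := fun f => rfl
      right_inv := fun φ => rfl }
  rw [Nat.card_congr e, Nat.card_eq_fintype_card, Fintype.card_subtype, Finset.card_filter]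
  push_cast
  refine Finset.sum_congr rfl fun φ _ => ?_
  rw [Finset.prod_ite_zero]
  simp

end Copies

/-! ### The random graph as a binomial random set of edges -/

section Slots

/-- The `n.choose 2` potential edges of a graph on `n` labelled vertices. -/
def slots (n : ℕ) : Finset (Sym2 (Fin n)) := {e | ¬ e.IsDiag}

variable {n : ℕ}

theorem mem_slots {e : Sym2 (Fin n)} : e ∈ slots n ↔ ¬ e.IsDiag := by simp [slots]

theorem card_slots (n : ℕ) : (slots n).card = n.choose 2 := by
  have := Sym2.ncard_diagSet_compl (α := Fin n)
  rw [Nat.card_eq_fintype_card, Fintype.card_fin] at this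
  rw [← this, ← Set.ncard_coe_finset]
  congr 1
  ext e
  simp [mem_slots]

theorem edgeSet_fromEdgeSet_of_subset_slots {A : Finset (Sym2 (Fin n))} (hA : A ⊆ slots n) :
    (SimpleGraph.fromEdgeSet (A : Set (Sym2 (Fin n)))).edgeSet = A := by
  rw [SimpleGraph.edgeSet_fromEdgeSet, sdiff_eq_left, Set.disjoint_left]
  exact fun e he => mem_slots.1 (hA he)

theorem measurableSingletonClass_simpleGraph : MeasurableSingletonClass (SimpleGraph (Fin n)) :=
  ⟨fun G => by
    have h := SimpleGraph.measurable_edgeSet (V := Fin n) (measurableSet_singleton G.edgeSet)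
    have h2 : SimpleGraph.edgeSet ⁻¹' {G.edgeSet} = {G} := by
      ext H
      simp
    rwa [h2] at h⟩

theorem integral_binomialRandom (p : unitInterval) (f : SimpleGraph (Fin n) → ℝ) :
    ∫ G, f G ∂(SimpleGraph.binomialRandom (Fin n) p) =
      bernoulliExp p (slots n) fun A => f (SimpleGraph.fromEdgeSet A) := by
  classical
  have := measurableSingletonClass_simpleGraph (n := n)
  rw [integral_fintype (Integrable.of_finite), bernoulliExp]
  symm
  refine Finset.sum_bij' (fun A _ => SimpleGraph.fromEdgeSet (A : Set (Sym2 (Fin n))))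
    (fun G _ => edges G) (fun _ _ => Finset.mem_univ _) (fun G _ => ?_) (fun A hA => ?_)
    (fun G _ => ?_) fun A hA => ?_
  · exact Finset.mem_powerset.2 fun e he =>
      mem_slots.2 (G.not_isDiag_of_mem_edgeSet ((mem_edges G).1 he))
  · ext e
    rw [mem_edges, edgeSet_fromEdgeSet_of_subset_slots (Finset.mem_powerset.1 hA)]
    simp
  · simp [edges]
  · rw [measureReal_def, SimpleGraph.binomialRandom_singleton,
      edgeSet_fromEdgeSet_of_subset_slots (Finset.mem_powerset.1 hA), Set.ncard_coe_finset,
      card_slots]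
    simp

end Slots

/-! ### Orthogonal decomposition of the subgraph counts -/

section Decomposition

theorem prod_indicator_eq_sum_centredProd {V W : Type*} [DecidableEq W] (p : ℝ)
    (E : Finset (Sym2 V)) (φ : V ↪ W) (A : Finset (Sym2 W)) :
    ∏ e ∈ E, (if φ.sym2Map e ∈ A then (1 : ℝ) else 0) =
      ∑ B ∈ E.powerset, p ^ (E.card - B.card) * centredProd p (B.map φ.sym2Map) A := by
  classical
  have h : ∀ e ∈ E, (if φ.sym2Map e ∈ A then (1 : ℝ) else 0) =
      ((if φ.sym2Map e ∈ A then 1 else 0) - p) + p := fun e _ => by ring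
  rw [Finset.prod_congr rfl h, Finset.prod_add]
  refine Finset.sum_congr rfl fun B hB => ?_
  rw [Finset.prod_const, Finset.card_sdiff_of_subset (Finset.mem_powerset.1 hB), centredProd,
    Finset.prod_map, mul_comm]

variable {V : Type*} [Fintype V] (Γ : SimpleGraph V) (p : unitInterval) (n : ℕ)

theorem copyCount_fromEdgeSet {A : Finset (Sym2 (Fin n))} (hA : A ⊆ slots n) :
    ((SimpleGraph.fromEdgeSet (A : Set (Sym2 (Fin n)))).copyCount Γ : ℝ) =
      (Nat.card (Γ ≃g Γ) : ℝ)⁻¹ * ∑ φ : V ↪ Fin n, ∑ B ∈ (edges Γ).powerset,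
        (p : ℝ) ^ ((edges Γ).card - B.card) * centredProd p (B.map φ.sym2Map) A := by
  have : Finite (Γ ≃g Γ) :=
    Finite.of_injective (fun f : Γ ≃g Γ => (f : V → V)) DFunLike.coe_injective
  have h0 : (Nat.card (Γ ≃g Γ) : ℝ) ≠ 0 :=
    Nat.cast_ne_zero.2 (Nat.card_pos_iff.2 ⟨⟨SimpleGraph.Iso.refl⟩, this⟩).ne'
  rw [eq_inv_mul_iff_mul_eq₀ h0, mul_comm, ← Nat.cast_mul, copyCount_mul_card_aut,
    card_copy_eq_sum]
  refine Finset.sum_congr rfl fun φ _ => ?_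
  rw [← prod_indicator_eq_sum_centredProd]
  refine Finset.prod_congr rfl fun e _ => ?_
  simp only [edgeSet_fromEdgeSet_of_subset_slots hA, Finset.mem_coe]

theorem map_edges_subset_slots {B : Finset (Sym2 V)} (hB : B ⊆ edges Γ) (φ : V ↪ Fin n) :
    B.map φ.sym2Map ⊆ slots n := by
  intro e he
  obtain ⟨e', he', rfl⟩ := Finset.mem_map.1 he
  have := Γ.not_isDiag_of_mem_edgeSet ((mem_edges Γ).1 (hB he'))
  rw [mem_slots]
  induction e' using Sym2.ind with
  | _ a b => simpa using this

/-- The sets of at least two edges of `Γ`. -/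
noncomputable def multiEdges : Finset (Finset (Sym2 V)) := {B ∈ (edges Γ).powerset | 2 ≤ B.card}

theorem mem_multiEdges {B : Finset (Sym2 V)} : B ∈ multiEdges Γ ↔ B ⊆ edges Γ ∧ 2 ≤ B.card := by
  simp [multiEdges]

theorem card_multiEdges_le : (multiEdges Γ).card ≤ 2 ^ (edges Γ).card :=
  (Finset.card_filter_le _ _).trans (Finset.card_powerset _).le

theorem sum_powerset_edges (F : Finset (Sym2 V) → ℝ) :
    ∑ B ∈ (edges Γ).powerset, F B = F ∅ + ∑ e ∈ edges Γ, F {e} + ∑ B ∈ multiEdges Γ, F B := by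
  classical
  have h : {B ∈ (edges Γ).powerset | ¬ 2 ≤ B.card} =
      insert ∅ ((edges Γ).map ⟨fun e => ({e} : Finset (Sym2 V)), Finset.singleton_injective⟩) := by
    ext B
    have hB : ¬ 2 ≤ B.card ↔ B = ∅ ∨ ∃ e, B = {e} := by
      rw [← Finset.card_eq_zero, ← Finset.card_eq_one]; omega
    simp only [Finset.mem_filter, Finset.mem_powerset, hB, Finset.mem_insert, Finset.mem_map,
      Function.Embedding.coeFn_mk]
    constructor
    · rintro ⟨hs, rfl | ⟨e, rfl⟩⟩
      · exact Or.inl rfl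
      · exact Or.inr ⟨e, Finset.singleton_subset_iff.1 hs, rfl⟩
    · rintro (rfl | ⟨e, he, rfl⟩)
      · exact ⟨Finset.empty_subset _, Or.inl rfl⟩
      · exact ⟨Finset.singleton_subset_iff.2 he, Or.inr ⟨e, rfl⟩⟩
  rw [← Finset.sum_filter_not_add_sum_filter _ (fun B => 2 ≤ B.card), h, Finset.sum_insert (by simp),
    Finset.sum_map]
  rfl

/-- By symmetry, the image of a fixed edge under a uniformly random embedding is uniformly
distributed. -/
theorem sum_embedding_sym2Map (hn : 2 ≤ n) {e : Sym2 V} (he : e ∈ edges Γ)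
    (F : Sym2 (Fin n) → ℝ) :
    ∑ φ : V ↪ Fin n, F (φ.sym2Map e) =
      n.descFactorial (Fintype.card V) / (n.choose 2 : ℝ) * ∑ f ∈ slots n, F f := by
  have hmaps : ∀ φ ∈ (Finset.univ : Finset (V ↪ Fin n)), φ.sym2Map e ∈ slots n := fun φ _ =>
    map_edges_subset_slots Γ n (Finset.singleton_subset_iff.2 he) φ (by simp)
  set N : Sym2 (Fin n) → ℕ := fun f => Finset.card {φ : V ↪ Fin n | φ.sym2Map e = f} with hN
  have hsum : ∀ F : Sym2 (Fin n) → ℝ,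
      ∑ φ : V ↪ Fin n, F (φ.sym2Map e) = ∑ f ∈ slots n, N f * F f := fun F => by
    rw [← Finset.sum_fiberwise_of_maps_to hmaps]
    refine Finset.sum_congr rfl fun f _ => ?_
    rw [Finset.sum_congr rfl fun φ hφ => congrArg F (Finset.mem_filter.1 hφ).2, Finset.sum_const,
      nsmul_eq_mul]
  -- the permutations of the labels act transitively on the potential edges
  have hconst : ∀ f ∈ slots n, ∀ f' ∈ slots n, N f = N f' := by
    have hle : ∀ f ∈ slots n, ∀ f' ∈ slots n, N f ≤ N f' := fun f hf f' hf' => by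
      induction f using Sym2.ind with
      | _ x y =>
      induction f' using Sym2.ind with
      | _ x' y' =>
      obtain ⟨π, hx, hy⟩ := (MulAction.is_two_pretransitive_iff (G := Equiv.Perm (Fin n))).1
        (Equiv.Perm.isMultiplyPretransitive (Fin n) 2)
        (by simpa [mem_slots] using hf) (by simpa [mem_slots] using hf')
      refine Finset.card_le_card_of_injOn (fun φ => φ.trans π.toEmbedding) (fun φ hφ => ?_)
        fun φ _ ψ _ h => by
          ext a
          have := DFunLike.congr_fun h a
          simpa [Fin.val_inj] using this
      have h1 : φ.sym2Map e = s(x, y) := by simpa using hφ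
      have h2 : (φ.trans π.toEmbedding).sym2Map e = Sym2.map π (φ.sym2Map e) := by
        simp [Function.Embedding.sym2Map, Sym2.map_map]
      simp only [Finset.coe_filter, Finset.mem_univ, true_and, Set.mem_ofPred_eq]
      rw [h2, h1, Sym2.map_mk]
      exact congrArg₂ (fun a b => s(a, b)) hx hy
    exact fun f hf f' hf' => (hle f hf f' hf').antisymm (hle f' hf' f hf)
  have hpos : 0 < n.choose 2 := Nat.choose_pos hn
  obtain ⟨f₀, hf₀⟩ : (slots n).Nonempty := Finset.card_pos.1 (by rwa [card_slots])
  have hF : ∀ F : Sym2 (Fin n) → ℝ, ∑ φ : V ↪ Fin n, F (φ.sym2Map e) = N f₀ * ∑ f ∈ slots n, F f :=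
    fun F => by
      rw [hsum, Finset.mul_sum]
      exact Finset.sum_congr rfl fun f hf => by rw [hconst f hf f₀ hf₀]
  have h1 := hF fun _ => 1
  simp only [Finset.sum_const, Finset.card_univ, Fintype.card_embedding_eq, Fintype.card_fin,
    nsmul_eq_mul, mul_one, card_slots] at h1
  have hpos' : (n.choose 2 : ℝ) ≠ 0 := Nat.cast_ne_zero.2 hpos.ne'
  rw [hF, h1, mul_div_cancel_right₀ _ hpos']

/-- The coefficient of the centred number of edges in the normalized count of copies of `Γ`. -/
noncomputable def edgeCoeff : ℝ :=
  (n : ℝ) ^ (1 - (Fintype.card V : ℤ)) * (Nat.card (Γ ≃g Γ) : ℝ)⁻¹ *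
    ((edges Γ).card * (p : ℝ) ^ ((edges Γ).card - 1) *
      (n.descFactorial (Fintype.card V) / (n.choose 2 : ℝ)))

/-- The part of the normalized count of copies of `Γ` that consists of the products of at least
two centred edge indicators, as a function of the edge set of the random graph. -/
noncomputable def remainder (A : Finset (Sym2 (Fin n))) : ℝ :=
  (n : ℝ) ^ (1 - (Fintype.card V : ℤ)) * (Nat.card (Γ ≃g Γ) : ℝ)⁻¹ *
    ∑ φ : V ↪ Fin n, ∑ B ∈ multiEdges Γ,
      (p : ℝ) ^ ((edges Γ).card - B.card) * centredProd p (B.map φ.sym2Map) A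

theorem normalizedCount_eq (hn : 2 ≤ n) {A : Finset (Sym2 (Fin n))} (hA : A ⊆ slots n) :
    normalizedCount Γ p n (SimpleGraph.fromEdgeSet A) =
      edgeCoeff Γ p n * (A.card - p * (slots n).card) + remainder Γ p n A := by
  have hmean : ∫ H, (SimpleGraph.copyCount H Γ : ℝ) ∂(SimpleGraph.binomialRandom (Fin n) p) =
      (Nat.card (Γ ≃g Γ) : ℝ)⁻¹ * ∑ φ : V ↪ Fin n, (p : ℝ) ^ (edges Γ).card := by
    rw [integral_binomialRandom, bernoulliExp_congr fun A hA => copyCount_fromEdgeSet Γ p n hA,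
      bernoulliExp_const_mul, bernoulliExp_sum]
    congr 1
    refine Finset.sum_congr rfl fun φ _ => ?_
    rw [bernoulliExp_sum, Finset.sum_eq_single_of_mem ∅ (Finset.empty_mem_powerset _)]
    · simp [centredProd, bernoulliExp_const]
    · intro B hB hne
      rw [bernoulliExp_const_mul, bernoulliExp_centredProd (map_edges_subset_slots Γ n
        (Finset.mem_powerset.1 hB) φ) ((Finset.map_nonempty).2
          (Finset.nonempty_iff_ne_empty.2 hne)), mul_zero]
  have hlin : ∑ φ : V ↪ Fin n, ∑ e ∈ edges Γ, (p : ℝ) ^ ((edges Γ).card - 1) *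
      ((if φ.sym2Map e ∈ A then 1 else 0) - (p : ℝ)) = (edges Γ).card *
      (p : ℝ) ^ ((edges Γ).card - 1) * (n.descFactorial (Fintype.card V) / (n.choose 2 : ℝ)) *
        (A.card - p * (slots n).card) := by
    have hS : ∑ f ∈ slots n, ((if f ∈ A then 1 else 0) - (p : ℝ)) =
        A.card - p * (slots n).card := by
      rw [Finset.sum_sub_distrib, Finset.sum_const, nsmul_eq_mul, Finset.sum_boole,
        Finset.filter_mem_eq_inter, Finset.inter_eq_right.2 hA, mul_comm (p : ℝ)]
    rw [Finset.sum_comm, Finset.sum_congr rfl fun e he => by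
      rw [← Finset.mul_sum, sum_embedding_sym2Map Γ n hn he fun f =>
        (if f ∈ A then 1 else 0) - (p : ℝ), hS], Finset.sum_const, nsmul_eq_mul]
    ring
  rw [normalizedCount, hmean, copyCount_fromEdgeSet Γ p n hA, edgeCoeff, remainder]
  simp only [sum_powerset_edges, Finset.sum_add_distrib]
  simp only [Finset.map_empty, Finset.map_singleton, Finset.card_empty, Finset.card_singleton,
    centredProd, Finset.prod_empty, Finset.prod_singleton, tsub_zero, mul_one]
  rw [hlin]
  ring

end Decomposition

/-! ### Bounds for the remainder and for the coefficient of the edge count -/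

section Bounds

variable {V : Type*} [Fintype V] (Γ : SimpleGraph V) (p : unitInterval) {n : ℕ}

/-- Two different edges of a graph cover at least three vertices. -/
theorem exists_three_vertices {B : Finset (Sym2 V)} (hB : B ∈ multiEdges Γ) :
    ∃ T : Finset V, T.card = 3 ∧ ∀ x ∈ T, ∃ e ∈ B, x ∈ e := by
  classical
  obtain ⟨hBE, hB2⟩ := (mem_multiEdges Γ).1 hB
  obtain ⟨e, he, e', he', hne⟩ := Finset.one_lt_card.1 hB2
  have hd := Γ.not_isDiag_of_mem_edgeSet ((mem_edges Γ).1 (hBE he))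
  have hd' := Γ.not_isDiag_of_mem_edgeSet ((mem_edges Γ).1 (hBE he'))
  induction e using Sym2.ind with
  | _ a b =>
  have hab : a ≠ b := by simpa using hd
  obtain ⟨c, hc, hce⟩ : ∃ c ∈ e', c ∉ s(a, b) := by
    by_contra! h
    induction e' using Sym2.ind with
    | _ x y =>
    have hx := h x (by simp)
    have hy := h y (by simp)
    have hxy : x ≠ y := by simpa using hd'
    rw [Sym2.mem_iff] at hx hy
    apply hne
    rw [Sym2.eq_iff]
    grind
  rw [Sym2.mem_iff, not_or] at hce
  refine ⟨{a, b, c}, Finset.card_eq_three.2 ⟨a, b, c, hab, Ne.symm hce.1, Ne.symm hce.2, rfl⟩, ?_⟩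
  intro x hx
  simp only [Finset.mem_insert, Finset.mem_singleton] at hx
  obtain rfl | rfl | rfl := hx
  · exact ⟨_, he, by simp⟩
  · exact ⟨_, he, by simp⟩
  · exact ⟨_, he', hc⟩

/-- If `φ` maps two edges of `Γ` into the image of `ψ`, then it maps three vertices into a set of
`Fintype.card V` elements. -/
theorem card_embedding_map_eq_mul_le {B C : Finset (Sym2 V)} (hB : B ∈ multiEdges Γ)
    (ψ : V ↪ Fin n) :
    Finset.card {φ : V ↪ Fin n | B.map φ.sym2Map = C.map ψ.sym2Map} * n ^ 3 ≤
      Fintype.card V ^ 3 * n ^ Fintype.card V := by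
  classical
  obtain ⟨T, hT, hTB⟩ := exists_three_vertices Γ hB
  set t : V → Finset (Fin n) := fun x => if x ∈ T then Finset.univ.map ψ else Finset.univ
  have hle : Finset.card {φ : V ↪ Fin n | B.map φ.sym2Map = C.map ψ.sym2Map} ≤
      (Fintype.piFinset t).card := by
    refine Finset.card_le_card_of_injOn (fun φ => φ) (fun φ hφ => ?_)
      DFunLike.coe_injective.injOn
    have hφ : B.map φ.sym2Map = C.map ψ.sym2Map := by simpa using hφ
    refine Finset.mem_coe.2 (Fintype.mem_piFinset.2 fun x => ?_)
    by_cases hx : x ∈ T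
    · obtain ⟨e, he, hxe⟩ := hTB x hx
      have : φ.sym2Map e ∈ C.map ψ.sym2Map := hφ ▸ Finset.mem_map_of_mem _ he
      obtain ⟨f, -, hf⟩ := Finset.mem_map.1 this
      have hφx : φ x ∈ ψ.sym2Map f := by
        rw [hf]
        exact Sym2.mem_map.2 ⟨x, hxe, rfl⟩
      obtain ⟨y, -, hy⟩ := Sym2.mem_map.1 hφx
      simp only [t, if_pos hx]
      exact Finset.mem_map.2 ⟨y, Finset.mem_univ y, hy⟩
    · simp [t, hx]
  have hcard : (Fintype.piFinset t).card * n ^ 3 = Fintype.card V ^ 3 * n ^ Fintype.card V := by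
    have h1 : ∀ x, (t x).card = if x ∈ T then Fintype.card V else n := fun x => by
      by_cases hx : x ∈ T <;> simp [t, hx]
    have h3 : 3 ≤ Fintype.card V := hT ▸ Finset.card_le_univ T
    rw [Fintype.card_piFinset, Finset.prod_congr rfl fun x _ => h1 x, Finset.prod_ite,
      Finset.prod_const, Finset.prod_const, Finset.filter_mem_eq_inter, Finset.univ_inter, hT,
      mul_assoc, ← pow_add, Finset.filter_not, Finset.filter_mem_eq_inter, Finset.univ_inter,
      Finset.card_sdiff_of_subset (Finset.subset_univ T), hT, Finset.card_univ,
      Nat.sub_add_cancel h3]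
  exact (Nat.mul_le_mul_right _ hle).trans hcard.le

theorem one_le_card_aut : (1 : ℝ) ≤ Nat.card (Γ ≃g Γ) := by
  have : Finite (Γ ≃g Γ) :=
    Finite.of_injective (fun f : Γ ≃g Γ => (f : V → V)) DFunLike.coe_injective
  exact_mod_cast Nat.card_pos_iff.2 ⟨⟨SimpleGraph.Iso.refl⟩, this⟩

theorem prefactor_nonneg :
    0 ≤ (n : ℝ) ^ (1 - (Fintype.card V : ℤ)) * (Nat.card (Γ ≃g Γ) : ℝ)⁻¹ := by positivity

theorem prefactor_mul_pow_le (hn : 1 ≤ n) :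
    (n : ℝ) ^ (1 - (Fintype.card V : ℤ)) * (Nat.card (Γ ≃g Γ) : ℝ)⁻¹ *
      (n : ℝ) ^ Fintype.card V ≤ n := by
  have h0 : (n : ℝ) ≠ 0 := Nat.cast_ne_zero.2 (by omega)
  have : (n : ℝ) ^ (1 - (Fintype.card V : ℤ)) * (n : ℝ) ^ Fintype.card V = n := by
    rw [← zpow_natCast, ← zpow_add₀ h0]
    simp
  rw [mul_right_comm, this]
  exact mul_le_of_le_one_right (by positivity) (inv_le_one_of_one_le₀ (one_le_card_aut Γ))

theorem card_embedding_le : ((Finset.univ : Finset (V ↪ Fin n)).card : ℝ) ≤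
    (n : ℝ) ^ Fintype.card V := by
  rw [Finset.card_univ, Fintype.card_embedding_eq, Fintype.card_fin]
  exact_mod_cast Nat.descFactorial_le_pow n _

theorem pow_unitInterval_mem (k : ℕ) : 0 ≤ (p : ℝ) ^ k ∧ (p : ℝ) ^ k ≤ 1 :=
  ⟨pow_nonneg p.2.1 k, pow_le_one₀ p.2.1 p.2.2⟩

theorem bernoulliExp_remainder_sq_le (hn : 1 ≤ n) :
    bernoulliExp p (slots n) (fun A => remainder Γ p n A ^ 2) ≤
      (2 ^ (edges Γ).card * (2 ^ (edges Γ).card * (Fintype.card V : ℝ) ^ 3)) / n := by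
  classical
  set k := (n : ℝ) ^ (1 - (Fintype.card V : ℤ)) * (Nat.card (Γ ≃g Γ) : ℝ)⁻¹ with hk
  set w : Finset (Sym2 V) → ℝ := fun B => (p : ℝ) ^ ((edges Γ).card - B.card) with hw
  set J : Finset ((V ↪ Fin n) × Finset (Sym2 V)) := Finset.univ ×ˢ multiEdges Γ with hJ
  have hn0 : (0 : ℝ) < n := by exact_mod_cast hn
  have hR : ∀ A, remainder Γ p n A = k * ∑ x ∈ J, w x.2 *
      centredProd p (x.2.map x.1.sym2Map) A := fun A => by
    rw [hJ, Finset.sum_product]; rfl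
  have hE : bernoulliExp p (slots n) (fun A => remainder Γ p n A ^ 2) = k ^ 2 * ∑ y ∈ J, ∑ x ∈ J,
      (w y.2 * w x.2) * bernoulliExp p (slots n) (fun A =>
        centredProd p (y.2.map y.1.sym2Map) A * centredProd p (x.2.map x.1.sym2Map) A) := by
    simp only [hR, mul_pow, bernoulliExp_const_mul]
    simp only [sq (∑ x ∈ J, _), Finset.sum_mul_sum, bernoulliExp_sum, ← bernoulliExp_const_mul]
    congr 1
    refine Finset.sum_congr rfl fun y _ => Finset.sum_congr rfl fun x _ =>
      bernoulliExp_congr fun A _ => by ring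
  have hsub : ∀ x ∈ J, x.2.map x.1.sym2Map ⊆ slots n := fun x hx =>
    map_edges_subset_slots Γ n ((mem_multiEdges Γ).1 (Finset.mem_product.1 hx).2).1 x.1
  -- given `ψ`, `C` and `B`, only a fraction of order `n⁻³` of the embeddings `φ` contributes
  have hcount : ∀ y ∈ J, ∑ x ∈ J,
      (if y.2.map y.1.sym2Map = x.2.map x.1.sym2Map then (1 : ℝ) else 0) ≤
      2 ^ (edges Γ).card * ((Fintype.card V : ℝ) ^ 3 * n ^ Fintype.card V / n ^ 3) := fun y _ => by
    rw [hJ, Finset.sum_product_right]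
    refine (Finset.sum_le_card_nsmul _ _
      ((Fintype.card V : ℝ) ^ 3 * n ^ Fintype.card V / n ^ 3) fun B hB => ?_).trans ?_
    · rw [Finset.sum_boole, le_div_iff₀ (by positivity)]
      have := card_embedding_map_eq_mul_le (n := n) (C := y.2) Γ hB y.1
      simp only [eq_comm (a := Finset.map y.1.sym2Map y.2)]
      exact_mod_cast this
    · rw [nsmul_eq_mul]
      refine mul_le_mul_of_nonneg_right ?_ (by positivity)
      exact_mod_cast card_multiEdges_le Γ
  have hJcard : (J.card : ℝ) ≤ n ^ Fintype.card V * 2 ^ (edges Γ).card := by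
    rw [hJ, Finset.card_product]
    push_cast
    exact mul_le_mul card_embedding_le (by exact_mod_cast card_multiEdges_le Γ) (by positivity)
      (by positivity)
  have hk0 : 0 ≤ k := prefactor_nonneg Γ
  have hkn : k * (n : ℝ) ^ Fintype.card V ≤ n := prefactor_mul_pow_le Γ hn
  rw [hE]
  calc _ ≤ k ^ 2 * ∑ y ∈ J, ∑ x ∈ J,
        (if y.2.map y.1.sym2Map = x.2.map x.1.sym2Map then (1 : ℝ) else 0) := by
        refine mul_le_mul_of_nonneg_left (Finset.sum_le_sum fun y hy =>
          Finset.sum_le_sum fun x hx => (le_abs_self _).trans ?_) (by positivity)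
        have hwy := pow_unitInterval_mem p ((edges Γ).card - y.2.card)
        have hwx := pow_unitInterval_mem p ((edges Γ).card - x.2.card)
        rw [abs_mul, abs_of_nonneg (mul_nonneg hwy.1 hwx.1)]
        exact (mul_le_of_le_one_left (abs_nonneg _) (mul_le_one₀ hwy.2 hwx.1 hwx.2)).trans
          (abs_bernoulliExp_centredProd_mul_centredProd_le p.2.1 p.2.2 (hsub y hy) (hsub x hx))
    _ ≤ k ^ 2 * ((n ^ Fintype.card V * 2 ^ (edges Γ).card) *
        (2 ^ (edges Γ).card * ((Fintype.card V : ℝ) ^ 3 * n ^ Fintype.card V / n ^ 3))) := by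
        refine mul_le_mul_of_nonneg_left ?_ (by positivity)
        refine (Finset.sum_le_card_nsmul _ _ _ hcount).trans ?_
        rw [nsmul_eq_mul]
        exact mul_le_mul_of_nonneg_right hJcard (by positivity)
    _ = (k * n ^ Fintype.card V) ^ 2 *
        ((2 ^ (edges Γ).card * (2 ^ (edges Γ).card * (Fintype.card V : ℝ) ^ 3)) / n ^ 3) := by ring
    _ ≤ (n : ℝ) ^ 2 *
        ((2 ^ (edges Γ).card * (2 ^ (edges Γ).card * (Fintype.card V : ℝ) ^ 3)) / n ^ 3) := by
        gcongr
    _ = _ := by field_simp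

theorem abs_bernoulliExp_mul_remainder_le (hn : 1 ≤ n) {F : ℕ → ℝ} {K : ℝ}
    (hF : ∀ k, |F (k + 2) - 2 * F (k + 1) + F k| ≤ K) :
    |bernoulliExp p (slots n) (fun A => remainder Γ p n A * F A.card)| ≤
      n * (2 ^ (edges Γ).card * K) := by
  set k := (n : ℝ) ^ (1 - (Fintype.card V : ℤ)) * (Nat.card (Γ ≃g Γ) : ℝ)⁻¹ with hk
  have hK : 0 ≤ K := (abs_nonneg _).trans (hF 0)
  have hk0 : 0 ≤ k := prefactor_nonneg Γ
  have hE : bernoulliExp p (slots n) (fun A => remainder Γ p n A * F A.card) =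
      k * ∑ φ : V ↪ Fin n, ∑ B ∈ multiEdges Γ, (p : ℝ) ^ ((edges Γ).card - B.card) *
        bernoulliExp p (slots n) fun A => centredProd p (B.map φ.sym2Map) A * F A.card := by
    simp only [remainder, ← hk, mul_assoc k, bernoulliExp_const_mul, Finset.sum_mul, mul_assoc,
      bernoulliExp_sum]
  rw [hE, abs_mul, abs_of_nonneg hk0]
  have hterm : ∀ φ : V ↪ Fin n, |∑ B ∈ multiEdges Γ, (p : ℝ) ^ ((edges Γ).card - B.card) *
      bernoulliExp p (slots n) fun A => centredProd p (B.map φ.sym2Map) A * F A.card| ≤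
      2 ^ (edges Γ).card * K := fun φ => by
    refine (Finset.abs_sum_le_sum_abs _ _).trans
      ((Finset.sum_le_card_nsmul _ _ K fun B hB => ?_).trans ?_)
    · obtain ⟨hBE, hB2⟩ := (mem_multiEdges Γ).1 hB
      have hw := pow_unitInterval_mem p ((edges Γ).card - B.card)
      rw [abs_mul, abs_of_nonneg hw.1]
      exact (mul_le_of_le_one_left (abs_nonneg _) hw.2).trans
        (abs_bernoulliExp_centredProd_mul_card_le p.2.1 p.2.2 (map_edges_subset_slots Γ n hBE φ)
          (by rwa [Finset.card_map]) hF)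
    · rw [nsmul_eq_mul]
      exact mul_le_mul_of_nonneg_right (by exact_mod_cast card_multiEdges_le Γ) hK
  calc _ ≤ k * (n ^ Fintype.card V * (2 ^ (edges Γ).card * K)) := by
        refine mul_le_mul_of_nonneg_left ((Finset.abs_sum_le_sum_abs _ _).trans
          ((Finset.sum_le_card_nsmul _ _ _ fun φ _ => hterm φ).trans ?_)) hk0
        rw [nsmul_eq_mul]
        exact mul_le_mul_of_nonneg_right card_embedding_le (by positivity)
    _ = k * n ^ Fintype.card V * (2 ^ (edges Γ).card * K) := by ring
    _ ≤ _ := mul_le_mul_of_nonneg_right (prefactor_mul_pow_le Γ hn) (by positivity)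

theorem edgeCoeff_nonneg : 0 ≤ edgeCoeff Γ p n := by
  have := (pow_unitInterval_mem p ((edges Γ).card - 1)).1
  unfold edgeCoeff
  positivity

theorem edgeCoeff_le (hn : 2 ≤ n) : edgeCoeff Γ p n ≤ 4 * (edges Γ).card / n := by
  have hn' : (2 : ℝ) ≤ n := by exact_mod_cast hn
  have hp := pow_unitInterval_mem p ((edges Γ).card - 1)
  have hch : (n : ℝ) ^ 2 / 4 ≤ n.choose 2 := by rw [Nat.cast_choose_two]; nlinarith
  have hd : (n.descFactorial (Fintype.card V) : ℝ) ≤ (n : ℝ) ^ Fintype.card V := by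
    exact_mod_cast Nat.descFactorial_le_pow n _
  have h0 := prefactor_nonneg (n := n) Γ
  unfold edgeCoeff
  calc _ ≤ (n : ℝ) ^ (1 - (Fintype.card V : ℤ)) * (Nat.card (Γ ≃g Γ) : ℝ)⁻¹ *
        ((edges Γ).card * 1 * ((n : ℝ) ^ Fintype.card V / ((n : ℝ) ^ 2 / 4))) := by
        gcongr
        exact hp.2
    _ = ((n : ℝ) ^ (1 - (Fintype.card V : ℤ)) * (Nat.card (Γ ≃g Γ) : ℝ)⁻¹ *
        (n : ℝ) ^ Fintype.card V) * ((edges Γ).card / ((n : ℝ) ^ 2 / 4)) := by ring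
    _ ≤ n * ((edges Γ).card / ((n : ℝ) ^ 2 / 4)) := by
        gcongr
        exact prefactor_mul_pow_le Γ (by omega)
    _ = _ := by field_simp

theorem descFactorial_div_pow_ge (v : ℕ) (hn : 1 ≤ n) :
    1 - (v : ℝ) ^ 2 / n ≤ n.descFactorial v / (n : ℝ) ^ v := by
  have hn0 : (0 : ℝ) < n := by exact_mod_cast hn
  rcases le_total v n with h | h
  · have hvn : (v : ℝ) ≤ n := by exact_mod_cast h
    calc 1 - (v : ℝ) ^ 2 / n = 1 + v * (-(v / n)) := by ring
      _ ≤ (1 + -(v / n)) ^ v := one_add_mul_le_pow (by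
          have : (v : ℝ) / n ≤ 1 := (div_le_one hn0).2 hvn
          linarith) v
      _ = ((n : ℝ) - v) ^ v / (n : ℝ) ^ v := by rw [← div_pow]; congr 1; field_simp; ring
      _ ≤ _ := by
          gcongr
          calc ((n : ℝ) - v) ^ v = ((n - v : ℕ) : ℝ) ^ v := by rw [Nat.cast_sub h]
            _ ≤ ((n + 1 - v : ℕ) : ℝ) ^ v := by gcongr; omega
            _ ≤ _ := by exact_mod_cast Nat.pow_sub_le_descFactorial n v
  · have hvn : (n : ℝ) ≤ v := by exact_mod_cast h
    have hv1 : (1 : ℝ) ≤ v := le_trans (by exact_mod_cast hn) hvn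
    have : 1 ≤ (v : ℝ) ^ 2 / n := by rw [le_div_iff₀ hn0]; nlinarith
    have h0 : (0 : ℝ) ≤ n.descFactorial v / (n : ℝ) ^ v := by positivity
    linarith

/-- The standard deviation of the edge part of the normalized count converges to `σ_Γ` at rate
`1 / n`. -/
theorem abs_sqrt_mul_edgeCoeff_sub_sigma_le (hn : 2 ≤ n) :
    |Real.sqrt (n.choose 2 * (p * (1 - p))) * edgeCoeff Γ p n - sigma Γ p| ≤
      sigma Γ p * ((Fintype.card V : ℝ) ^ 2 + 2) / n := by
  have hn' : (2 : ℝ) ≤ n := by exact_mod_cast hn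
  have hn0 : (0 : ℝ) < n := by linarith
  set v := Fintype.card V
  set r : ℝ := Real.sqrt (n * (n - 1)) with hr
  have hrlo : (n : ℝ) - 1 ≤ r := Real.le_sqrt_of_sq_le (by nlinarith)
  have hrhi : r ≤ n := Real.sqrt_le_iff.2 ⟨hn0.le, by nlinarith⟩
  have hr0 : 0 < r := by linarith
  have hrr : r * r = n * (n - 1) := Real.mul_self_sqrt (by nlinarith)
  have hs0 : 0 ≤ sigma Γ p := by
    have := (pow_unitInterval_mem p (Γ.edgeSet.ncard - 1)).1
    unfold sigma
    positivity
  -- the standard deviation of the edge part is exactly `sigma Γ p * ρ`, and `ρ = 1 + O(1 / n)`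
  set ρ : ℝ := n.descFactorial v / (n : ℝ) ^ v * (n / r) with hρ
  have e : Real.sqrt (n.choose 2 * (p * (1 - p))) * edgeCoeff Γ p n = sigma Γ p * ρ := by
    have h1 : Real.sqrt (n.choose 2 * (p * (1 - p))) = r / 2 * Real.sqrt (2 * p * (1 - p)) := by
      have : (n.choose 2 * (p * (1 - p)) : ℝ) = (r / 2) ^ 2 * (2 * p * (1 - p)) := by
        rw [Nat.cast_choose_two, div_pow, sq r, hrr]; ring
      rw [this, Real.sqrt_mul (sq_nonneg _), Real.sqrt_sq (by positivity)]
    have h2 : (n : ℝ) ^ (1 - (v : ℤ)) = n / (n : ℝ) ^ v := by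
      rw [zpow_sub₀ hn0.ne', zpow_one, zpow_natCast]
    rw [h1, edgeCoeff, h2, Nat.cast_choose_two, ← hrr, sigma, card_edges, hρ]
    field_simp
    rfl
  have hlo : 1 - (v : ℝ) ^ 2 / n ≤ ρ := by
    refine (descFactorial_div_pow_ge v (by omega)).trans (le_mul_of_one_le_right (by positivity) ?_)
    rwa [one_le_div hr0]
  have hhi : ρ ≤ 1 + 2 / n := by
    have ha : (n.descFactorial v : ℝ) / (n : ℝ) ^ v ≤ 1 :=
      div_le_one_of_le₀ (by exact_mod_cast Nat.descFactorial_le_pow n v) (by positivity)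
    refine (mul_le_of_le_one_left (by positivity) ha).trans ?_
    rw [div_le_iff₀ hr0]
    have : (1 + 2 / n) * ((n : ℝ) - 1) ≤ (1 + 2 / n) * r := by gcongr
    refine le_trans ?_ this
    have : (1 + 2 / n) * ((n : ℝ) - 1) = n + (n - 2) / n := by field_simp; ring
    rw [this]
    have : 0 ≤ ((n : ℝ) - 2) / n := div_nonneg (by linarith) hn0.le
    linarith
  have hρ1 : |ρ - 1| ≤ ((v : ℝ) ^ 2 + 2) / n := by
    rw [add_div, abs_le]
    have h1 : 0 ≤ (v : ℝ) ^ 2 / n := by positivity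
    have h2 : 0 ≤ (2 : ℝ) / n := by positivity
    constructor <;> linarith
  calc _ = sigma Γ p * |ρ - 1| := by
        rw [e, ← mul_sub_one, abs_mul, abs_of_nonneg hs0]
    _ ≤ sigma Γ p * (((v : ℝ) ^ 2 + 2) / n) := by gcongr
    _ = _ := by ring

end Bounds

/-! ### The limiting Gaussian measure -/

/-- The limiting Gaussian vector is a deterministic multiple of one standard Gaussian variable. -/
theorem multivariateGaussian_limitCov {d : ℕ} {V : Fin d → Type*} (Γ : ∀ i, SimpleGraph (V i))
    (p : unitInterval) :
    multivariateGaussian 0 (limitCov Γ p) = (gaussianReal 0 1).map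
      fun z : ℝ => z • (WithLp.toLp 2 fun i => sigma (Γ i) p : EuclideanSpace ℝ (Fin d)) := by
  have hm : Measurable fun z : ℝ =>
      z • (WithLp.toLp 2 fun i => sigma (Γ i) p : EuclideanSpace ℝ (Fin d)) := by fun_prop
  have : IsProbabilityMeasure ((gaussianReal 0 1).map fun z : ℝ =>
      z • (WithLp.toLp 2 fun i => sigma (Γ i) p : EuclideanSpace ℝ (Fin d))) :=
    Measure.isProbabilityMeasure_map hm.aemeasurable
  refine Measure.ext_of_charFun ?_
  ext t
  rw [charFun_multivariateGaussian (limitCov_posSemidef Γ p), charFun_apply,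
    integral_map hm.aemeasurable (by fun_prop)]
  set a : ℝ := ∑ i, sigma (Γ i) p * t i with ha
  have h1 := charFun_gaussianReal (μ := 0) (v := 1) a
  rw [charFun_apply_real] at h1
  have hi : ∀ z : ℝ, (inner ℝ (z • (WithLp.toLp 2 fun i => sigma (Γ i) p :
      EuclideanSpace ℝ (Fin d))) t : ℝ) = a * z := fun z => by
    rw [real_inner_smul_left, PiLp.inner_apply, ha, mul_comm]
    simp [mul_comm]
  have hq : (t : Fin d → ℝ) ⬝ᵥ (limitCov Γ p).mulVec t = a ^ 2 := by
    have : (limitCov Γ p).mulVec t = fun i => sigma (Γ i) p * a := by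
      ext i
      simp [limitCov, Matrix.mulVec, dotProduct, ha, Finset.mul_sum, mul_assoc]
    rw [this, sq, dotProduct, ha, Finset.sum_mul]
    exact Finset.sum_congr rfl fun i _ => by ring
  simp only [hi, hq]
  push_cast at h1 ⊢
  rw [h1]
  simp

/-! ### The three comparisons -/

section Comparison

variable {d : ℕ} {V : Fin d → Type*} [∀ i, Fintype (V i)] (Γ : ∀ i, SimpleGraph (V i))
  (p : unitInterval) {n : ℕ} {g : EuclideanSpace ℝ (Fin d) → ℝ}

theorem integral_countLaw (hg : g ∈ testFunctions d) (hn : 2 ≤ n) :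
    ∫ x, g x ∂countLaw Γ p n = bernoulliExp p (slots n) fun A =>
      g ((A.card - p * (slots n).card : ℝ) • WithLp.toLp 2 (fun i => edgeCoeff (Γ i) p n) +
        WithLp.toLp 2 fun i => remainder (Γ i) p n A) := by
  rw [countLaw, integral_map (measurable_countVector Γ p n).aemeasurable
    (continuous_testFunction hg).aestronglyMeasurable, integral_binomialRandom]
  refine bernoulliExp_congr fun A hA => congrArg g ?_
  ext i
  simp [countVector, normalizedCount_eq (Γ i) p n hn hA, mul_comm]

theorem sum_abs_edgeCoeff_le (hn : 2 ≤ n) :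
    ∑ i, |edgeCoeff (Γ i) p n| ≤ (∑ i, 4 * ((edges (Γ i)).card : ℝ)) / n := by
  rw [Finset.sum_div]
  refine Finset.sum_le_sum fun i _ => ?_
  rw [abs_of_nonneg (edgeCoeff_nonneg _ _)]
  exact edgeCoeff_le _ _ hn

/-- Removing the remainder: its first order effect is small because it is almost uncorrelated with
smooth functions of the number of edges, its second order effect because its variance is small. -/
theorem abs_integral_countLaw_sub_le (hg : g ∈ testFunctions d) (hn : 2 ≤ n) :
    |∫ x, g x ∂countLaw Γ p n - bernoulliExp p (slots n) fun A =>
      g ((A.card - p * (slots n).card : ℝ) • WithLp.toLp 2 fun i => edgeCoeff (Γ i) p n)| ≤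
      (d * ∑ i, 2 ^ (edges (Γ i)).card * (2 ^ (edges (Γ i)).card * (Fintype.card (V i) : ℝ) ^ 3) +
        ∑ i, 2 ^ (edges (Γ i)).card * (∑ j, 4 * ((edges (Γ j)).card : ℝ)) ^ 2) / n := by
  have hn0 : (0 : ℝ) < n := by positivity
  set c : EuclideanSpace ℝ (Fin d) := WithLp.toLp 2 fun i => edgeCoeff (Γ i) p n with hc
  set L := ∑ j, 4 * ((edges (Γ j)).card : ℝ) with hL
  have hcL : ∑ i, |c i| ≤ L / n := sum_abs_edgeCoeff_le Γ p hn
  set S : Finset (Sym2 (Fin n)) → ℝ := fun A => A.card - p * (slots n).card with hS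
  set G : Fin d → ℕ → ℝ := fun i k => partialDeriv i g ((k - p * (slots n).card : ℝ) • c) with hG
  have hlin : ∀ i, |bernoulliExp p (slots n) fun A => remainder (Γ i) p n A * G i A.card| ≤
      2 ^ (edges (Γ i)).card * L ^ 2 / n := fun i => by
    refine (abs_bernoulliExp_mul_remainder_le (Γ i) p (by omega) (K := (L / n) ^ 2)
      fun k => ?_).trans_eq (by field_simp)
    have := abs_second_difference_partialDeriv_le hg i c (k - p * (slots n).card)
    refine le_trans ?_ (this.trans (pow_le_pow_left₀
      (Finset.sum_nonneg fun _ _ => abs_nonneg _) hcL 2))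
    simp only [hG]
    push_cast
    rw [add_sub_right_comm, add_sub_right_comm]
  have hexp : (bernoulliExp p (slots n) fun A => g (S A • c +
        WithLp.toLp 2 fun i => remainder (Γ i) p n A)) -
      (bernoulliExp p (slots n) fun A => g (S A • c)) =
      (bernoulliExp p (slots n) fun A => g (S A • c + WithLp.toLp 2 fun i => remainder (Γ i) p n A) -
        g (S A • c) - ∑ i, remainder (Γ i) p n A * G i A.card) +
      ∑ i, bernoulliExp p (slots n) fun A => remainder (Γ i) p n A * G i A.card := by
    rw [bernoulliExp_sub, bernoulliExp_sub, bernoulliExp_sum]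
    ring
  have hquad : |bernoulliExp p (slots n) fun A =>
      g (S A • c + WithLp.toLp 2 fun i => remainder (Γ i) p n A) -
        g (S A • c) - ∑ i, remainder (Γ i) p n A * G i A.card| ≤
      d * ∑ i, (2 ^ (edges (Γ i)).card *
        (2 ^ (edges (Γ i)).card * (Fintype.card (V i) : ℝ) ^ 3)) / n := by
    refine (abs_bernoulliExp_le_of_le p.2.1 p.2.2
      (g := fun A => d * ∑ i, remainder (Γ i) p n A ^ 2) fun A _ => ?_).trans ?_
    · refine (testFunction_taylor hg (S A • c)
        (WithLp.toLp 2 fun i => remainder (Γ i) p n A)).trans ?_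
      have := sq_sum_le_card_mul_sum_sq (s := (Finset.univ : Finset (Fin d)))
        (f := fun i => |remainder (Γ i) p n A|)
      simpa using this
    · rw [bernoulliExp_const_mul, bernoulliExp_sum]
      refine mul_le_mul_of_nonneg_left (Finset.sum_le_sum fun i _ => ?_) (by positivity)
      exact bernoulliExp_remainder_sq_le (Γ i) p (by omega)
  rw [integral_countLaw Γ p hg hn, hexp, add_div, ← mul_div_assoc', Finset.sum_div, Finset.sum_div]
  exact (abs_add_le _ _).trans (add_le_add hquad ((Finset.abs_sum_le_sum_abs _ _).trans
    (Finset.sum_le_sum fun i _ => hlin i)))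

/-- The variance of a Bernoulli variable. -/
noncomputable def bernoulliVar : NNReal :=
  ⟨p * (1 - p), mul_nonneg p.2.1 (sub_nonneg.2 p.2.2)⟩

theorem abs_bernoulliExp_edgePart_sub_le (hg : g ∈ testFunctions d) (hn : 2 ≤ n) :
    |bernoulliExp p (slots n) (fun A =>
        g ((A.card - p * (slots n).card : ℝ) • WithLp.toLp 2 fun i => edgeCoeff (Γ i) p n)) -
      ∫ z, g (z • WithLp.toLp 2 fun i => edgeCoeff (Γ i) p n)
        ∂gaussianReal 0 ((slots n).card * bernoulliVar p)| ≤
      (∑ i, 4 * ((edges (Γ i)).card : ℝ)) ^ 3 *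
        (1 + ∫ y, |y| ^ 3 ∂gaussianReal 0 (bernoulliVar p)) / n := by
  have hn0 : (0 : ℝ) < n := by positivity
  set c : EuclideanSpace ℝ (Fin d) := WithLp.toLp 2 fun i => edgeCoeff (Γ i) p n with hc
  set L := ∑ j, 4 * ((edges (Γ j)).card : ℝ) with hL
  set m := ∫ y, |y| ^ 3 ∂gaussianReal 0 (bernoulliVar p) with hm
  have hm0 : 0 ≤ m := integral_nonneg fun _ => by positivity
  have hcL : ∑ i, |c i| ≤ L / n := sum_abs_edgeCoeff_le Γ p hn
  have hcard : ((slots n).card : ℝ) ≤ (n : ℝ) ^ 2 := by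
    rw [card_slots]
    exact_mod_cast Nat.choose_le_pow n 2
  have hc0 : 0 ≤ ∑ i, |c i| := Finset.sum_nonneg fun _ _ => abs_nonneg _
  calc _ ≤ (slots n).card * ((∑ i, |c i|) ^ 3 * (1 + m)) :=
        abs_bernoulliExp_sub_gaussian_le p.2.1 p.2.2 (v := bernoulliVar p) rfl (slots n)
          (hasTaylor_testFunction_smul hg c)
    _ ≤ (n : ℝ) ^ 2 * ((L / n) ^ 3 * (1 + m)) := by gcongr
    _ = _ := by field_simp

theorem abs_gaussian_edgePart_sub_le (hg : g ∈ testFunctions d) (hn : 2 ≤ n) :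
    |(∫ z, g (z • WithLp.toLp 2 fun i => edgeCoeff (Γ i) p n)
        ∂gaussianReal 0 ((slots n).card * bernoulliVar p)) -
      ∫ x, g x ∂multivariateGaussian 0 (limitCov Γ p)| ≤
      (∑ i, sigma (Γ i) p * ((Fintype.card (V i) : ℝ) ^ 2 + 2)) *
        (∫ z, |z| ∂gaussianReal 0 1) / n := by
  set c : EuclideanSpace ℝ (Fin d) := WithLp.toLp 2 fun i => edgeCoeff (Γ i) p n with hc
  set s : EuclideanSpace ℝ (Fin d) := WithLp.toLp 2 fun i => sigma (Γ i) p with hs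
  set a : ℝ := Real.sqrt (n.choose 2 * (p * (1 - p))) with ha
  have hgc := continuous_testFunction hg
  have hscale : gaussianReal 0 ((slots n).card * bernoulliVar p) =
      (gaussianReal 0 1).map (a * ·) := by
    rw [gaussianReal_map_const_mul, mul_zero, mul_one]
    congr 1
    ext
    have h0 : (0 : ℝ) ≤ n.choose 2 * (p * (1 - p)) :=
      mul_nonneg (by positivity) (bernoulliVar p).2
    change (((slots n).card * bernoulliVar p : NNReal) : ℝ) = a ^ 2
    rw [ha, Real.sq_sqrt h0, NNReal.coe_mul, NNReal.coe_natCast, card_slots]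
    rfl
  have hi : ∀ v : EuclideanSpace ℝ (Fin d), Integrable (fun z : ℝ => g (z • v))
      (gaussianReal 0 1) := fun v => (hasTaylor_testFunction_smul hg v).integrable 1
  have hint : Integrable (fun z : ℝ => |z|) (gaussianReal 0 1) := by
    simpa using (integrable_pow_gaussianReal 1 1).norm
  rw [multivariateGaussian_limitCov, hscale, integral_map (by fun_prop)
    (by exact (hgc.comp (by fun_prop)).aestronglyMeasurable),
    integral_map (by fun_prop) hgc.aestronglyMeasurable]
  have hi' : Integrable (fun z : ℝ => g ((a * z) • c)) (gaussianReal 0 1) := by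
    have := hi (a • c)
    simpa only [smul_smul, mul_comm a] using this
  rw [← integral_sub hi' (hi s)]
  refine abs_integral_le_integral_abs.trans ?_
  rw [mul_div_right_comm, ← integral_const_mul]
  refine integral_mono (hi'.sub (hi s)).abs (hint.const_mul _) fun z => ?_
  refine (testFunction_lipschitz hg _ _).trans ?_
  rw [Finset.sum_div, Finset.sum_mul]
  refine Finset.sum_le_sum fun i _ => ?_
  calc _ = |a * edgeCoeff (Γ i) p n - sigma (Γ i) p| * |z| := by
        rw [← abs_mul]
        simp only [PiLp.smul_apply, hc, hs, smul_eq_mul]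
        congr 1
        ring
    _ ≤ _ := mul_le_mul_of_nonneg_right (abs_sqrt_mul_edgeCoeff_sub_sigma_le (Γ i) p hn)
        (abs_nonneg _)

theorem exists_abs_integral_countLaw_sub_gaussian_le :
    ∃ C : ℝ, ∀ n : ℕ, 2 ≤ n → ∀ g ∈ testFunctions d,
      |∫ x, g x ∂countLaw Γ p n - ∫ x, g x ∂multivariateGaussian 0 (limitCov Γ p)| ≤ C / n := by
  refine ⟨
    (d * ∑ i, 2 ^ (edges (Γ i)).card * (2 ^ (edges (Γ i)).card * (Fintype.card (V i) : ℝ) ^ 3) +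
        ∑ i, 2 ^ (edges (Γ i)).card * (∑ j, 4 * ((edges (Γ j)).card : ℝ)) ^ 2) +
      (∑ i, 4 * ((edges (Γ i)).card : ℝ)) ^ 3 *
        (1 + ∫ y, |y| ^ 3 ∂gaussianReal 0 (bernoulliVar p)) +
      (∑ i, sigma (Γ i) p * ((Fintype.card (V i) : ℝ) ^ 2 + 2)) *
        (∫ z, |z| ∂gaussianReal 0 1), fun n hn g hg => ?_⟩
  rw [add_div, add_div]
  exact (abs_sub_le _ _ _).trans (add_le_add ((abs_sub_le _ _ _).trans (add_le_add
    (abs_integral_countLaw_sub_le Γ p hg hn) (abs_bernoulliExp_edgePart_sub_le Γ p hg hn)))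
    (abs_gaussian_edgePart_sub_le Γ p hg hn))

end Comparison

end SubgraphCLT

theorem mainTheorem3 {d : ℕ} {V : Fin d → Type*} [∀ i, Fintype (V i)]
    (Γ : ∀ i, SimpleGraph (V i)) (hΓ : ∀ i, (Γ i).edgeSet.Nonempty)
    (p : unitInterval) (hp0 : 0 < p) (hp1 : p < 1) :
    ∃ c : ℝ, 0 < c ∧ ∀ᶠ n : ℕ in Filter.atTop,
      SubgraphCLT.d4 (SubgraphCLT.countLaw Γ p n)
        (ProbabilityTheory.multivariateGaussian 0 (SubgraphCLT.limitCov Γ p)) ≤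
          ENNReal.ofReal (c / n) := by
  obtain ⟨C, hC⟩ := SubgraphCLT.exists_abs_integral_countLaw_sub_gaussian_le Γ p
  refine ⟨max 1 C, by positivity, ?_⟩
  filter_upwards [Filter.eventually_ge_atTop 2] with n hn
  refine iSup₂_le fun g hg => ENNReal.ofReal_le_ofReal ((hC n hn g hg).trans ?_)
  gcongr
  exact le_max_right _ _
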